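/- Let $1\le n\le n_r$. Consider the multiblock fading channel $Y_i=H_iX_i+W_i$, $i=1,\dots,k$, where $X_i\in M_n(\mathbb C)$, the noise matrices $W_i\in M_{n_r\times n}(\mathbb C)$ have i.i.d. circularly symmetric complex Gaussian entries of mean $0$ and variance $1$, and the fading process $\{H_i\}_{i\in\mathcal I}$ ($\mathcal I=\mathbb Z$ or $\mathbb N$), with values in $M_{n_r\times n}(\mathbb C)$, is independent of the noise and known to the receiver only. Suppose that $\{H_i\}$ is stationary and ergodic, that the distribution of $H_i$ is invariant under right multiplication by unitary matrices, that $H_i$ has full rank with probability $1$, and that $\mathbb E\,|\log\det H^\dagger H|<\infty$, where $H$ has the common distribution of the $H_i$. All logarithms are to base $2$. For $X=(X_1,\dots,X_k)\in M_{n\times nk}(\mathbb C)$ write $\|X\|$ for the Frobenius norm. Let $K$ be an infinite set of positive integers and, for $k\in K$, let $L_{n,k}\subset M_{n\times nk}(\mathbb C)$ be a lattice of full dimension $2n^2k$ with $$\inf_{0\ne X\in L_{n,k}}\prod_{i=1}^k|\det X_i|=1,\qquad \mathrm{Vol}(L_{n,k})^{\frac1{n^2k}}\le C_L,$$ where $C_L>0$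 is a constant and $\mathrm{Vol}$ is the volume of the fundamental parallelotope for the inner product $\Re\,\mathrm{Tr}(XY^\dagger)$. For $P>0$ put $$R^*(P)=\mathbb E\Big[\log\det\tfrac Pn H^\dagger H\Big]-n\log C_L+n\log\frac{\pi e}{4n}.$$ (1) For every $P>0$, every rate $R<R^*(P)$ is achievable with the lattices $L_{n,k}$, both with maximum likelihood decoding and with naive lattice decoding. That is, let $\alpha_k>0$ be given by $$\alpha_k^2=\frac{C_{n,k}^{1/(n^2k)}P}{2^{R/n}\,\mathrm{Vol}(L_{n,k})^{1/(n^2k)}},\qquad C_{n,k}=\frac{(\pi nk)^{n^2k}}{(n^2k)!}.$$ Then there are shifts $S_k\in M_{n\times nk}(\mathbb C)$ such that the finite codes $$\mathcal C_k=\{X\in S_k+\alpha_kL_{n,k}:\ \|X\|^2\le Pnk\}$$ satisfy $|\mathcal C_k|\ge 2^{Rnk}$ for all $k\in K$, and the error probability (maximized over the transmitted codeword, ties counted as errors) tends to $0$ as $k\to\infty$ in $K$, both for maximum likelihood decoding in $\mathcal C_k$ and for closest point search in the whole set $S_k+\alpha_kL_{n,k}$. (2) Let $$C(P)=\sup_{Q\succeq0,\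 \mathrm{tr}\,Q\le P}\mathbb E\big[\log\det(I_{n_r}+HQH^\dagger)\big]\in[0,\infty]$$ be the ergodic capacity. If $C(P_0)<\infty$ for some $P_0>0$, then there is a constant $\Delta$, not depending on $P$, such that $$C(P)\le\max(0,R^*(P))+\Delta\qquad\text{for all }P>0.$$ -/

import Mathlib

open MeasureTheory ProbabilityTheory Filter Topology
open scoped Matrix ENNReal ComplexOrder

noncomputable section

namespace Multiblock

/-- The entrywise (that is, Borel) σ-algebra on complex matrices. -/
instance matrixMeasurableSpace (m n : Type*) : MeasurableSpace (Matrix m n ℂ) :=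
  inferInstanceAs (MeasurableSpace (m → n → ℂ))

/-! ### Multiblock matrices and lattices -/

/-- `k`-tuples `(X₁, …, X_k)` of complex `m × n` matrices. For `m = n` this is the space
`M_{n × nk}(ℂ)`, an element being written as a row of `k` square blocks. -/
abbrev Blocks (m n k : ℕ) : Type := Fin k → Matrix (Fin m) (Fin n) ℂ

/-- The real inner product `⟨X, Y⟩ = Re Tr (X Y†) = ∑ᵢ Re Tr (Xᵢ Yᵢ†)`. -/
def realInner {m n k : ℕ} (X Y : Blocks m n k) : ℝ :=
  ∑ i, ((X i * (Y i)ᴴ).trace).re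

/-- The squared Frobenius norm. -/
def normSq {m n k : ℕ} (X : Blocks m n k) : ℝ := realInner X X

/-- `pdet (X) = ∏ᵢ det (Xᵢ)`. -/
def pdet {n k : ℕ} (X : Blocks n n k) : ℂ := ∏ i, (X i).det

/-- A matrix lattice `ℤ B₁ ⊕ ⋯ ⊕ ℤ B_r` in `M_{n × nk}(ℂ)`, given by a lattice basis: `r` matrices
that are linearly independent over `ℝ`. -/
structure MatrixLattice (n k r : ℕ) where
  basis : Fin r → Blocks n n k
  linearIndependent : LinearIndependent ℝ basis

namespace MatrixLattice

variable {n k r : ℕ}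

/-- The set of lattice points. -/
def points (L : MatrixLattice n k r) : AddSubgroup (Blocks n n k) :=
  AddSubgroup.closure (Set.range L.basis)

/-- The Gram matrix of the lattice basis. -/
def gram (L : MatrixLattice n k r) : Matrix (Fin r) (Fin r) ℝ :=
  Matrix.of fun i j => realInner (L.basis i) (L.basis j)

/-- The volume of the fundamental parallelotope. -/
def vol (L : MatrixLattice n k r) : ℝ := √|L.gram.det|

/-- The minimum determinant: the infimum of `|pdet X|` over the nonzero lattice points. -/
def mindet (L : MatrixLattice n k r) : ℝ :=
  sInf ((fun X => ‖pdet X‖) '' {X | X ∈ L.points ∧ X ≠ 0})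

/-- The scaled and shifted lattice `S + α L`. -/
def shifted (L : MatrixLattice n k r) (α : ℝ) (S : Blocks n n k) : Set (Blocks n n k) :=
  {X | ∃ Y ∈ L.points, X = S + α • Y}

/-- The code `B(√(Pkn)) ∩ (S + α L)`: the points of the scaled and shifted lattice that satisfy the
power constraint `‖X‖² / (nk) ≤ P`. -/
def code (L : MatrixLattice n k r) (P α : ℝ) (S : Blocks n n k) : Set (Blocks n n k) :=
  {X | normSq X ≤ P * k * n} ∩ L.shifted α S

/-- The energy normalization constant `α` of rate `R` and power `P`, given by
`α² = C^{1/(n²k)} P / (2^{R/n} Vol(L)^{1/(n²k)})` with `C = (π n k)^{n²k} / (n²k)!`.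
It is the `α` for which `Vol (B(√(Pkn))) = 2^{Rnk} Vol (α L)` when `L` has full dimension `2n²k`. -/
def scaling (L : MatrixLattice n k r) (P R : ℝ) : ℝ :=
  √((((Real.pi * n * k) ^ (n ^ 2 * k) / ((n ^ 2 * k).factorial : ℝ)) ^
        (1 / ((n : ℝ) ^ 2 * k)) * P) /
      ((2 : ℝ) ^ (R / n) * L.vol ^ (1 / ((n : ℝ) ^ 2 * k))))

end MatrixLattice

/-! ### The channel and the decoders -/

/-- The channel output `Yᵢ = Hᵢ Xᵢ + Wᵢ`, `i = 1, …, k`. -/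
def output {nr n k : ℕ} (H : Blocks nr n k) (X : Blocks n n k) (W : Blocks nr n k) :
    Blocks nr n k := fun i => H i * X i + W i

/-- The likelihood of the codeword `X`: the conditional density of the output at `Y` given `X` and
the channel `H`, for noise with i.i.d. circularly symmetric complex Gaussian entries of variance
`1`. -/
def likelihood {nr n k : ℕ} (H : Blocks nr n k) (Y : Blocks nr n k) (X : Blocks n n k) : ℝ :=
  ∏ i, ∏ a, ∏ b, Real.pi⁻¹ * Real.exp (-‖Y i a b - (H i * X i) a b‖ ^ 2)

/-- Error of maximum likelihood decoding over the finite code `C` when `X` is sent: `X` is not the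
unique maximizer of the likelihood in `C`. (Ties count as errors.) -/
def MLError {nr n k : ℕ} (C : Set (Blocks n n k)) (H : Blocks nr n k) (X : Blocks n n k)
    (W : Blocks nr n k) : Prop :=
  ∃ X' ∈ C, X' ≠ X ∧ likelihood H (output H X W) X ≤ likelihood H (output H X W) X'

/-- Error of naive lattice decoding, that is, closest point search in the whole infinite (scaled
and shifted) lattice `Λ`, when `X` is sent: `X` is not the unique closest point. (Ties count as
errors.) -/
def NaiveLatticeError {nr n k : ℕ} (Λ : Set (Blocks n n k)) (H : Blocks nr n k) (X : Blocks n n k)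
    (W : Blocks nr n k) : Prop :=
  ∃ X' ∈ Λ, X' ≠ X ∧
    normSq (fun i => output H X W i - H i * X' i) ≤ normSq (fun i => output H X W i - H i * X i)

variable {Ω 𝓘 : Type*} [MeasurableSpace Ω] {nr n : ℕ}

/-- The realization at `ω` of the first `k` blocks, numbered `1, …, k`, of a matrix process. -/
def firstBlocks [NatCast 𝓘] (H : 𝓘 → Ω → Matrix (Fin nr) (Fin n) ℂ) (k : ℕ) (ω : Ω) :
    Blocks nr n k := fun i => H (((i : ℕ) + 1 : ℕ) : 𝓘) ω

/-- The (maximal, over the codewords `X` of `C`) error probability of ML decoding. -/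
def mlErrorProb [NatCast 𝓘] (μ : Measure Ω) (H : 𝓘 → Ω → Matrix (Fin nr) (Fin n) ℂ)
    (W : ℕ → Ω → Matrix (Fin nr) (Fin n) ℂ) {k : ℕ} (C : Set (Blocks n n k)) : ℝ≥0∞ :=
  ⨆ X ∈ C, μ {ω | MLError C (firstBlocks H k ω) X (firstBlocks W k ω)}

/-- The (maximal, over the codewords `X` of `C`) error probability of naive lattice decoding in
`Λ`. -/
def naiveErrorProb [NatCast 𝓘] (μ : Measure Ω) (H : 𝓘 → Ω → Matrix (Fin nr) (Fin n) ℂ)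
    (W : ℕ → Ω → Matrix (Fin nr) (Fin n) ℂ) {k : ℕ} (C Λ : Set (Blocks n n k)) : ℝ≥0∞ :=
  ⨆ X ∈ C, μ {ω | NaiveLatticeError Λ (firstBlocks H k ω) X (firstBlocks W k ω)}

/-- The rate `R` (in bits per complex channel use) is achievable under the power constraint `P` with
the lattices `L k`, `k ∈ K`, both with ML decoding and with naive lattice decoding: there are shifts
`S k` such that the codes `B(√(Pkn)) ∩ (S k + α_k L k)` have at least `2^{Rnk}` words, and the
error probabilities of both decoders tend to `0` as `k → ∞` in `K`. (As `Set.ncard` of an infinite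
set is `0`, the cardinality bound includes the finiteness of the codes.) -/
def Achievable [NatCast 𝓘] (μ : Measure Ω) (H : 𝓘 → Ω → Matrix (Fin nr) (Fin n) ℂ)
    (W : ℕ → Ω → Matrix (Fin nr) (Fin n) ℂ) (K : Set ℕ)
    (L : ∀ k : ℕ, MatrixLattice n k (2 * n ^ 2 * k)) (P R : ℝ) : Prop :=
  ∃ S : ∀ k : ℕ, Blocks n n k,
    (∀ k ∈ K, (2 : ℝ) ^ (R * n * k) ≤ (((L k).code P ((L k).scaling P R) (S k)).ncard : ℝ)) ∧
    Tendsto (fun k => mlErrorProb μ H W ((L k).code P ((L k).scaling P R) (S k)))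
      (atTop ⊓ 𝓟 K) (𝓝 0) ∧
    Tendsto (fun k => naiveErrorProb μ H W ((L k).code P ((L k).scaling P R) (S k))
      ((L k).shifted ((L k).scaling P R) (S k))) (atTop ⊓ 𝓟 K) (𝓝 0)

/-! ### Assumptions on the noise and on the fading process -/

/-- The circularly symmetric complex Gaussian law with mean `0` and variance `1` (that is, `1/2` per
real dimension). -/
def complexGaussian : Measure ℂ :=
  ((gaussianReal 0 (1 / 2)).prod (gaussianReal 0 (1 / 2))).map fun p => (⟨p.1, p.2⟩ : ℂ)

/-- The noise matrices `W j`: all entries, of all blocks, are independent with law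
`complexGaussian`. -/
structure IsWhiteNoise (μ : Measure Ω) (W : ℕ → Ω → Matrix (Fin nr) (Fin n) ℂ) : Prop where
  measurable : ∀ j, Measurable (W j)
  law : ∀ j a b, μ.map (fun ω => W j ω a b) = complexGaussian
  indep : iIndepFun (fun (p : ℕ × Fin nr × Fin n) ω => W p.1 ω p.2.1 p.2.2) μ

/-- The shift `(T x)ᵢ = x_{i+1}` on sequences indexed by `𝓘` (which is `ℕ` or `ℤ`). -/
def shift (𝓘 : Type*) [AddMonoidWithOne 𝓘] (E : Type*) (x : 𝓘 → E) : 𝓘 → E := fun i => x (i + 1)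

/-- Stationarity: the joint law of `(H_{i₁ + t}, …, H_{i_m + t})` does not depend on `t ∈ ℕ`. -/
def IsStationary [AddMonoidWithOne 𝓘] (μ : Measure Ω)
    (H : 𝓘 → Ω → Matrix (Fin nr) (Fin n) ℂ) : Prop :=
  ∀ (t m : ℕ) (i : Fin m → 𝓘),
    μ.map (fun ω (j : Fin m) => H (i j) ω) = μ.map (fun ω (j : Fin m) => H (i j + (t : 𝓘)) ω)

/-- Ergodicity: every shift-invariant measurable set of sequences has probability `0` or `1` under
the law of the process. -/
def IsErgodic [AddMonoidWithOne 𝓘] (μ : Measure Ω)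
    (H : 𝓘 → Ω → Matrix (Fin nr) (Fin n) ℂ) : Prop :=
  PreErgodic (shift 𝓘 (Matrix (Fin nr) (Fin n) ℂ)) (μ.map fun ω i => H i ω)

/-- Isotropic invariance: the law of each `H i` is invariant under right multiplication by unitary
matrices. -/
def IsIsotropic (μ : Measure Ω) (H : 𝓘 → Ω → Matrix (Fin nr) (Fin n) ℂ) : Prop :=
  ∀ i, ∀ U ∈ Matrix.unitaryGroup (Fin n) ℂ, μ.map (fun ω => H i ω * U) = μ.map (H i)

/-! ### Rates and capacity -/

/-- `log₂ det (c H†H)` for a channel matrix `H`; the determinant is a nonnegative real number. -/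
def logDet (c : ℝ) (H : Matrix (Fin nr) (Fin n) ℂ) : ℝ :=
  Real.logb 2 (((c : ℂ) • (Hᴴ * H)).det).re

/-- `E[log₂ det ((P/n) H†H)] - n log₂ C_L + n log₂ (π e / (4n))` for a random channel matrix `H`. -/
def latticeRate (μ : Measure Ω) (H : Ω → Matrix (Fin nr) (Fin n) ℂ) (CL P : ℝ) : ℝ :=
  ∫ ω, logDet (P / n) (H ω) ∂μ - n * Real.logb 2 CL +
    n * Real.logb 2 (Real.pi * Real.exp 1 / (4 * n))

/-- The ergodic capacity `C(P) = max_{Q ≥ 0, tr Q ≤ P} E[log₂ det (I + H Q H†)]`, where `H` has the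
first-order law of the fading process. The integrand is nonnegative, and the supremum is taken in
`[0, ∞]`. -/
def ergodicCapacity (μ : Measure Ω) (H : Ω → Matrix (Fin nr) (Fin n) ℂ) (P : ℝ) : ℝ≥0∞ :=
  ⨆ Q : Matrix (Fin n) (Fin n) ℂ, ⨆ _ : Q.PosSemidef ∧ Q.trace.re ≤ P,
    ∫⁻ ω, ENNReal.ofReal (Real.logb 2 ((1 + H ω * Q * (H ω)ᴴ).det).re) ∂μ

end Multiblock

end

/-! Part (1). Suppose lattice decoding prefers a point at displacement `D = α Z`, with `Z` a nonzero
lattice point, and put `A = H D`. Then `2⟨W, A⟩ ≥ ‖A‖²`. Only the projection `V` of the noise to the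
column spaces of the `H_i` enters `⟨W, A⟩`, so expanding `‖A - 2V‖² ≥ 0` gives `‖A‖² ≤ 4‖V‖²`
(`normSq_le_four_mul_of_closer`). On the other hand the arithmetic-geometric mean inequality for the
squared singular values of all the blocks, together with `|pdet Z| ≥ 1`, gives `‖A‖² ≥ α² n k (∏ det
H_i†H_i)^{1/(nk)}` (`normSq_mul_ge`).

Both sides concentrate. By the mean ergodic theorem the geometric mean is at least `2^{(E-ε)/n}`
outside an event of vanishing probability, where `E = 𝔼 log det H†H`
(`tendsto_measure_logDet_average`). Conditionally on the channel, `‖V‖²` has mean `n²k` and variance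
linear in `k`, so Chebyshev's inequality bounds it by `n²k(1+ε)` (`IsWhiteNoise.measure_le`). By
Stirling's formula `α²` is asymptotically at least `e · πP / (n 2^{R/n} C_L)`. Errors are therefore
confined to the two bad events as soon as `4n` is less than this constant times `2^{E/n}`, and
taking logarithms turns that condition into `R < R*(P)` (`exists_slack`). The argument sees neither
the shift nor the codeword, so the shift may be chosen just to make the code large, by averaging
over translates (`exists_shift`). Maximum likelihood over the code errs only when the lattice
decoder does.

Part (2). With `T = tr H†H`, the capacity integrand is at most `n log(1 + P T)`. The covariance
`(P₀/n) I` shows that `𝔼 log(1 + (P₀/n) T)` is finite if `C(P₀)` is. Rescaling `P` costs at most `n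
log max(1, nP/P₀)`, while `R*(P) = n log P + const`, so the slopes agree and the gap stays bounded
(`exists_capacity_gap`). -/

noncomputable section

namespace Multiblock

/-! ### The mean ergodic theorem in `L¹` -/

section MeanErgodic

variable {X : Type*} [MeasurableSpace X] {ν : Measure X} {T : X → X}

theorem measurePreserving_birkhoffAverage_aestronglyMeasurable (hT : MeasurePreserving T ν ν)
    {f : X → ℝ} (hf : AEStronglyMeasurable f ν) (k : ℕ) :
    AEStronglyMeasurable (birkhoffAverage ℝ T f k) ν := by
  have : birkhoffAverage ℝ T f k = (k : ℝ)⁻¹ • ∑ j ∈ Finset.range k, f ∘ T^[j] := by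
    ext x
    simp [birkhoffAverage, birkhoffSum]
  rw [this]
  exact (Finset.aestronglyMeasurable_sum _ fun j _ =>
    hf.comp_measurePreserving (hT.iterate j)).const_smul _

/-- Birkhoff averages contract the `L¹` seminorm. -/
theorem eLpNorm_one_birkhoffAverage_le (hT : MeasurePreserving T ν ν)
    {f : X → ℝ} (hf : AEStronglyMeasurable f ν) (k : ℕ) :
    eLpNorm (birkhoffAverage ℝ T f k) 1 ν ≤ eLpNorm f 1 ν := by
  have : birkhoffAverage ℝ T f k = (k : ℝ)⁻¹ • ∑ j ∈ Finset.range k, f ∘ T^[j] := by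
    ext x
    simp [birkhoffAverage, birkhoffSum]
  rw [this, eLpNorm_const_smul]
  have h1 : eLpNorm (∑ j ∈ Finset.range k, f ∘ T^[j]) 1 ν ≤ k * eLpNorm f 1 ν := by
    refine (eLpNorm_sum_le (fun j _ => hf.comp_measurePreserving (hT.iterate j)) le_rfl).trans ?_
    refine (Finset.sum_le_card_nsmul _ _ (eLpNorm f 1 ν) fun j _ => ?_).trans ?_
    · exact (eLpNorm_comp_measurePreserving hf (hT.iterate j)).le
    · simp
  refine (mul_le_mul_right h1 _).trans ?_
  rcases Nat.eq_zero_or_pos k with rfl | hk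
  · simp
  · rw [← mul_assoc]
    have : ‖(k : ℝ)⁻¹‖ₑ * (k : ℝ≥0∞) = 1 := by
      rw [Real.enorm_of_nonneg (by positivity), ENNReal.ofReal_inv_of_pos (by positivity),
        ENNReal.ofReal_natCast]
      exact ENNReal.inv_mul_cancel (by exact_mod_cast hk.ne') (by simp)
    rw [this, one_mul]

/-- Translates between averages of the Koopman operator on `L²`, where von Neumann's theorem
applies, and pointwise Birkhoff averages. -/
theorem coeFn_birkhoffAverage_comp (hT : MeasurePreserving T ν ν) {g : X → ℝ}
    (hg : MemLp g 2 ν) (k : ℕ) :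
    (birkhoffAverage ℝ (Lp.compMeasurePreservingₗᵢ ℝ T hT : Lp ℝ 2 ν →ₗᵢ[ℝ] Lp ℝ 2 ν) _root_.id k
      (hg.toLp g) : Lp ℝ 2 ν) =ᵐ[ν] birkhoffAverage ℝ T g k := by
  have hit : ∀ j : ℕ, ((⇑(Lp.compMeasurePreservingₗᵢ ℝ T hT : Lp ℝ 2 ν →ₗᵢ[ℝ] Lp ℝ 2 ν))^[j]
      (hg.toLp g) : Lp ℝ 2 ν) =ᵐ[ν] g ∘ T^[j] := by
    intro j
    have : ((⇑(Lp.compMeasurePreservingₗᵢ ℝ T hT : Lp ℝ 2 ν →ₗᵢ[ℝ] Lp ℝ 2 ν))^[j]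
      (hg.toLp g)) = Lp.compMeasurePreserving T^[j] (hT.iterate j) (hg.toLp g) := by
      rw [← Lp.compMeasurePreserving_iterate hT j]
      rfl
    rw [this]
    refine (Lp.coeFn_compMeasurePreserving _ _).trans ?_
    exact (hT.iterate j).quasiMeasurePreserving.ae_eq_comp hg.coeFn_toLp
  have hs : ∀ k : ℕ, ((∑ j ∈ Finset.range k,
      (⇑(Lp.compMeasurePreservingₗᵢ ℝ T hT : Lp ℝ 2 ν →ₗᵢ[ℝ] Lp ℝ 2 ν))^[j] (hg.toLp g) : Lp ℝ 2 ν)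
        : X → ℝ) =ᵐ[ν] ∑ j ∈ Finset.range k, g ∘ T^[j] := by
    intro k
    induction k with
    | zero => simpa using Lp.coeFn_zero ℝ 2 ν
    | succ k ih =>
      rw [Finset.sum_range_succ, Finset.sum_range_succ]
      exact (Lp.coeFn_add _ _).trans (ih.add (hit k))
  simp only [birkhoffAverage, birkhoffSum, _root_.id]
  refine (Lp.coeFn_smul _ _).trans ?_
  filter_upwards [hs k] with x hx
  rw [Pi.smul_apply, hx]
  simp [birkhoffAverage, birkhoffSum]

theorem integral_birkhoffAverage (hT : MeasurePreserving T ν ν) {g : X → ℝ}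
    (hg : Integrable g ν) {k : ℕ} (hk : k ≠ 0) :
    ∫ x, birkhoffAverage ℝ T g k x ∂ν = ∫ x, g x ∂ν := by
  simp only [birkhoffAverage, birkhoffSum, smul_eq_mul]
  rw [integral_const_mul, integral_finsetSum]
  · have : ∀ j, ∫ x, g (T^[j] x) ∂ν = ∫ x, g x ∂ν := by
      intro j
      have h := (hT.iterate j)
      rw [← integral_map h.measurable.aemeasurable
        (by rw [h.map_eq]; exact hg.aestronglyMeasurable), h.map_eq]
    simp only [this]
    have : (k : ℝ) ≠ 0 := by exact_mod_cast hk
    simp [this]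
  · intro j _
    exact (hT.iterate j).integrable_comp_of_integrable hg

/-- The mean ergodic theorem for square integrable functions, with convergence in `L¹`. -/
theorem tendsto_eLpNorm_birkhoffAverage_of_memLp_two [IsProbabilityMeasure ν]
    (hT : Ergodic T ν) {g : X → ℝ} (hg : MemLp g 2 ν) :
    Tendsto (fun k => eLpNorm (fun x => birkhoffAverage ℝ T g k x - ∫ y, g y ∂ν) 1 ν) atTop
      (𝓝 0) := by
  have hT' := hT.toMeasurePreserving
  set U : Lp ℝ 2 ν →ₗᵢ[ℝ] Lp ℝ 2 ν := Lp.compMeasurePreservingₗᵢ ℝ T hT' with hU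
  obtain ⟨p, hpU, hlim⟩ : ∃ p : Lp ℝ 2 ν, U p = p ∧
      Tendsto (birkhoffAverage ℝ U _root_.id · (hg.toLp g)) atTop (𝓝 p) := by
    -- Von Neumann: the averages of a contraction converge to the projection onto its fixed vectors.
    have := U.toContinuousLinearMap.tendsto_birkhoffAverage_orthogonalProjection
      U.norm_toContinuousLinearMap_le (hg.toLp g)
    refine ⟨_, ?_, this⟩
    exact ((U.toContinuousLinearMap.eqLocus (1 : Lp ℝ 2 ν →L[ℝ] Lp ℝ 2 ν)).orthogonalProjectionOnto
      (hg.toLp g)).2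
  -- Ergodicity makes the invariant limit constant; below, invariance of the integral under
  -- averaging identifies the constant.
  obtain ⟨c, hc⟩ : ∃ c, p =ᵐ[ν] Function.const X c := by
    refine hT.ae_eq_const_of_ae_eq_comp_ae (Lp.aestronglyMeasurable p) ?_
    have h1 := Lp.coeFn_compMeasurePreserving p hT'
    have h2 : Lp.compMeasurePreserving T hT' p = p := hpU
    rw [h2] at h1
    exact h1.symm
  have hlim2 : Tendsto (fun k => eLpNorm (fun x => birkhoffAverage ℝ T g k x - c) 2 ν) atTop
      (𝓝 0) := by
    rw [Lp.tendsto_Lp_iff_tendsto_eLpNorm'] at hlim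
    refine hlim.congr fun k => eLpNorm_congr_ae ?_
    filter_upwards [coeFn_birkhoffAverage_comp hT' hg k, hc] with x h1 h2
    simp only [Pi.sub_apply]
    rw [h1, h2]
    rfl
  have hlim1 : Tendsto (fun k => eLpNorm (fun x => birkhoffAverage ℝ T g k x - c) 1 ν) atTop
      (𝓝 0) := by
    refine tendsto_of_tendsto_of_tendsto_of_le_of_le tendsto_const_nhds hlim2
      (fun _ => zero_le) fun k => ?_
    exact eLpNorm_le_eLpNorm_of_exponent_le (by norm_num)
      ((measurePreserving_birkhoffAverage_aestronglyMeasurable hT' hg.1 k).sub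
        aestronglyMeasurable_const)
  have hgi : Integrable g ν := hg.integrable (by norm_num)
  have hci : c = ∫ y, g y ∂ν := by
    have h1 : Tendsto (fun k => ∫ x, (birkhoffAverage ℝ T g k x) ∂ν) atTop
        (𝓝 (∫ _, c ∂ν)) := by
      refine tendsto_integral_of_L1' _ aestronglyMeasurable_const (Eventually.of_forall fun k => ?_) ?_
      · rw [show birkhoffAverage ℝ T g k = (k : ℝ)⁻¹ • ∑ j ∈ Finset.range k, g ∘ T^[j] by
          ext x
          simp [birkhoffAverage, birkhoffSum]]
        exact (integrable_finsetSum' _ fun j _ =>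
          (hT'.iterate j).integrable_comp_of_integrable hgi).smul _
      · exact hlim1
    have h2 : Tendsto (fun k => ∫ x, (birkhoffAverage ℝ T g k x) ∂ν) atTop
        (𝓝 (∫ y, g y ∂ν)) := by
      refine tendsto_const_nhds.congr' ?_
      filter_upwards [eventually_ne_atTop 0] with k hk
      rw [integral_birkhoffAverage hT' hgi hk]
    simpa using tendsto_nhds_unique h1 h2
  rwa [hci] at hlim1

/-- The mean ergodic theorem in `L¹`. -/
theorem tendsto_eLpNorm_birkhoffAverage [IsProbabilityMeasure ν]
    (hT : Ergodic T ν) {f : X → ℝ} (hf : Integrable f ν) :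
    Tendsto (fun k => eLpNorm (fun x => birkhoffAverage ℝ T f k x - ∫ y, f y ∂ν) 1 ν) atTop
      (𝓝 0) := by
  have hT' := hT.toMeasurePreserving
  rw [ENNReal.tendsto_atTop_zero]
  intro ε hε
  have hε3 : ε / 3 ≠ 0 := (ENNReal.div_pos hε.ne' (by norm_num)).ne'
  obtain ⟨g, hgf, hg⟩ := (memLp_one_iff_integrable.2 hf).exists_simpleFunc_eLpNorm_sub_lt
    ENNReal.one_ne_top hε3
  have hg2 : MemLp g 2 ν := g.memLp_of_isFiniteMeasure 2 ν
  have hgi : Integrable g ν := hg2.integrable (by norm_num)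
  have := (ENNReal.tendsto_atTop_zero.1 (tendsto_eLpNorm_birkhoffAverage_of_memLp_two hT hg2))
    (ε / 3) (pos_iff_ne_zero.2 hε3)
  obtain ⟨N, hN⟩ := this
  refine ⟨N, fun k hk => ?_⟩
  -- An `ε/3` argument: the averages contract `L¹`, so approximation by a simple function `g` costs
  -- the same for every `k`.
  have hdecomp : (fun x => birkhoffAverage ℝ T f k x - ∫ y, f y ∂ν) =
      birkhoffAverage ℝ T (f - ⇑g) k + ((fun x => birkhoffAverage ℝ T g k x - ∫ y, g y ∂ν)
        + fun _ => ∫ y, (g y - f y) ∂ν) := by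
    ext x
    rw [integral_sub hgi hf]
    simp only [birkhoffAverage, birkhoffSum, Pi.add_apply, Pi.sub_apply, smul_eq_mul,
      Finset.sum_sub_distrib]
    ring
  have hm1 := measurePreserving_birkhoffAverage_aestronglyMeasurable hT'
    (hf.1.sub hgi.1) k
  have hm2 := (measurePreserving_birkhoffAverage_aestronglyMeasurable hT' hgi.1 k).sub
    (aestronglyMeasurable_const (b := ∫ y, g y ∂ν))
  rw [hdecomp]
  refine (eLpNorm_add_le hm1 (hm2.add aestronglyMeasurable_const) le_rfl).trans ?_
  have h3 : eLpNorm (fun _ : X => ∫ y, (g y - f y) ∂ν) 1 ν ≤ ε / 3 := by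
    rw [eLpNorm_const _ (by norm_num) (IsProbabilityMeasure.ne_zero ν)]
    simp only [measure_univ, ENNReal.toReal_one, ENNReal.one_rpow, mul_one]
    refine (enorm_integral_le_lintegral_enorm _).trans ?_
    rw [← eLpNorm_one_eq_lintegral_enorm]
    have : (fun y => g y - f y) = -(f - ⇑g) := by ext; simp
    rw [this, eLpNorm_neg]
    exact hgf.le
  calc _ ≤ ε / 3 + (ε / 3 + ε / 3) := by
        gcongr
        · exact (eLpNorm_one_birkhoffAverage_le hT' (hf.1.sub hgi.1) k).trans hgf.le
        · exact (eLpNorm_add_le hm2 aestronglyMeasurable_const le_rfl).trans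
            (add_le_add (hN k hk) h3)
    _ = ε := by rw [← add_assoc, ENNReal.add_thirds]

/-- The ergodic theorem, with convergence in probability. -/
theorem tendsto_measure_birkhoffAverage [IsProbabilityMeasure ν]
    (hT : Ergodic T ν) {f : X → ℝ} (hf : Integrable f ν) {ε : ℝ} (hε : 0 < ε) :
    Tendsto (fun k => ν {x | ε ≤ ‖birkhoffAverage ℝ T f k x - ∫ y, f y ∂ν‖}) atTop (𝓝 0) := by
  have h := tendstoInMeasure_of_tendsto_eLpNorm (p := 1) (l := atTop) (μ := ν)
    (f := fun k => birkhoffAverage ℝ T f k) (g := fun _ => ∫ y, f y ∂ν) one_ne_zero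
    (fun k => measurePreserving_birkhoffAverage_aestronglyMeasurable hT.toMeasurePreserving hf.1 k)
    aestronglyMeasurable_const (tendsto_eLpNorm_birkhoffAverage hT hf)
  rw [tendstoInMeasure_iff_norm] at h
  exact h ε hε

end MeanErgodic

/-! ### Determinant and trace of positive semidefinite matrices -/

section PosSemidef

variable {ι : Type*} [Fintype ι] [DecidableEq ι]

theorem _root_.Matrix.PosSemidef.re_det_eq_prod {M : Matrix ι ι ℂ} (hM : M.PosSemidef) :
    M.det.re = ∏ i, hM.1.eigenvalues i := by
  rw [hM.1.det_eq_prod_eigenvalues]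
  exact_mod_cast Complex.ofReal_re _

theorem _root_.Matrix.PosSemidef.re_trace_eq_sum {M : Matrix ι ι ℂ} (hM : M.PosSemidef) :
    M.trace.re = ∑ i, hM.1.eigenvalues i := by
  rw [hM.1.trace_eq_sum_eigenvalues]
  exact_mod_cast Complex.ofReal_re _

/-- Evaluate the characteristic polynomial at `-1`; the sign `(-1)^card` occurs on both sides and
cancels. -/
theorem _root_.Matrix.PosSemidef.re_det_one_add {M : Matrix ι ι ℂ} (hM : M.PosSemidef) :
    (1 + M).det.re = ∏ i, (1 + hM.1.eigenvalues i) := by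
  have h := Matrix.eval_charpoly M (-1)
  rw [hM.1.charpoly_eq, Polynomial.eval_prod] at h
  have h1 : (Matrix.scalar ι (-1 : ℂ) - M) = -(1 + M) := by
    rw [map_neg, map_one, neg_add, sub_eq_add_neg]
  rw [h1, Matrix.det_neg] at h
  have h2 : (1 + M).det = ∏ i, ((1 + hM.1.eigenvalues i : ℝ) : ℂ) := by
    have h3 : (-1 : ℂ) ^ Fintype.card ι * (-1 : ℂ) ^ Fintype.card ι = 1 := by
      rw [← mul_pow]; simp
    rw [← one_mul (1 + M).det, ← h3, mul_assoc, ← h, ← Finset.card_univ, ← Finset.prod_const,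
      ← Finset.prod_mul_distrib]
    refine Finset.prod_congr rfl fun i _ => ?_
    simp
    ring
  rw [h2]
  exact_mod_cast Complex.ofReal_re _

theorem _root_.Matrix.PosSemidef.re_det_one_add_le {M : Matrix ι ι ℂ} (hM : M.PosSemidef) :
    (1 + M).det.re ≤ (1 + M.trace.re) ^ Fintype.card ι := by
  rw [hM.re_det_one_add, hM.re_trace_eq_sum, ← Finset.card_univ, ← Finset.prod_const]
  refine Finset.prod_le_prod (fun i _ => ?_) fun i _ => ?_
  · linarith [hM.eigenvalues_nonneg i]
  · gcongr
    exact Finset.single_le_sum (fun j _ => hM.eigenvalues_nonneg j) (Finset.mem_univ i)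

theorem _root_.Matrix.PosSemidef.one_add_re_trace_le {M : Matrix ι ι ℂ} (hM : M.PosSemidef) :
    1 + M.trace.re ≤ (1 + M).det.re := by
  rw [hM.re_det_one_add, hM.re_trace_eq_sum]
  have key : ∀ s : Finset ι, 1 + ∑ i ∈ s, hM.1.eigenvalues i ≤
      ∏ i ∈ s, (1 + hM.1.eigenvalues i) := by
    intro s
    induction s using Finset.induction_on with
    | empty => simp
    | insert a s ha ih =>
      rw [Finset.sum_insert ha, Finset.prod_insert ha]
      have h1 := hM.eigenvalues_nonneg a
      have h2 : 0 ≤ ∑ i ∈ s, hM.1.eigenvalues i :=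
        Finset.sum_nonneg fun i _ => hM.eigenvalues_nonneg i
      nlinarith
  exact key _

end PosSemidef

/-! ### Frobenius geometry, received energy and projection to the column space -/

section Frobenius

variable {m n l k : ℕ}

theorem re_trace_mul_conjTranspose (A : Matrix (Fin m) (Fin n) ℂ) :
    (A * Aᴴ).trace.re = ∑ a, ∑ b, ‖A a b‖ ^ 2 := by
  simp only [Matrix.trace, Matrix.diag, Matrix.mul_apply, Matrix.conjTranspose_apply,
    Complex.re_sum]
  refine Finset.sum_congr rfl fun a _ => Finset.sum_congr rfl fun b _ => ?_
  rw [Complex.star_def, Complex.mul_conj, Complex.ofReal_re, Complex.normSq_eq_norm_sq]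

theorem re_trace_conjTranspose_mul (A : Matrix (Fin m) (Fin n) ℂ) :
    (Aᴴ * A).trace.re = ∑ a, ∑ b, ‖A a b‖ ^ 2 := by
  rw [Matrix.trace_mul_comm, re_trace_mul_conjTranspose]

/-- Submultiplicativity of the Frobenius norm, by Cauchy-Schwarz in each entry of the product. -/
theorem re_trace_mul_conjTranspose_mul_le (A : Matrix (Fin m) (Fin n) ℂ)
    (B : Matrix (Fin n) (Fin l) ℂ) :
    ((A * B) * (A * B)ᴴ).trace.re ≤ (A * Aᴴ).trace.re * (B * Bᴴ).trace.re := by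
  simp only [re_trace_mul_conjTranspose]
  rw [Finset.sum_comm (s := Finset.univ) (t := Finset.univ) (f := fun a b => ‖B a b‖ ^ 2),
    Finset.sum_mul_sum]
  refine Finset.sum_le_sum fun a _ => Finset.sum_le_sum fun b _ => ?_
  rw [Matrix.mul_apply]
  calc ‖∑ j, A a j * B j b‖ ^ 2 ≤ (∑ j, ‖A a j‖ * ‖B j b‖) ^ 2 := by
        gcongr
        refine (norm_sum_le _ _).trans (Finset.sum_le_sum fun j _ => (norm_mul _ _).le)
    _ ≤ _ := Finset.sum_mul_sq_le_sq_mul_sq _ _ _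

theorem normSq_eq (X : Blocks m n k) : normSq X = ∑ i, ∑ a, ∑ b, ‖X i a b‖ ^ 2 := by
  simp only [normSq, realInner, re_trace_mul_conjTranspose]

theorem normSq_nonneg (X : Blocks m n k) : 0 ≤ normSq X := by
  rw [normSq_eq]
  positivity

theorem realInner_comm (X Y : Blocks m n k) : realInner X Y = realInner Y X := by
  simp only [realInner]
  refine Finset.sum_congr rfl fun i _ => ?_
  rw [← Complex.conj_re, ← Complex.star_def, ← Matrix.trace_conjTranspose,
    Matrix.conjTranspose_mul, Matrix.conjTranspose_conjTranspose]

theorem realInner_add_left (X Y Z : Blocks m n k) :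
    realInner (X + Y) Z = realInner X Z + realInner Y Z := by
  simp [realInner, Matrix.add_mul, Finset.sum_add_distrib]

theorem realInner_smul_left (c : ℝ) (X Y : Blocks m n k) :
    realInner (c • X) Y = c * realInner X Y := by
  simp [realInner, Matrix.smul_mul, Finset.mul_sum]

theorem realInner_smul_right (c : ℝ) (X Y : Blocks m n k) :
    realInner X (c • Y) = c * realInner X Y := by
  rw [realInner_comm, realInner_smul_left, realInner_comm]

theorem normSq_add (X Y : Blocks m n k) :
    normSq (X + Y) = normSq X + 2 * realInner X Y + normSq Y := by
  unfold normSq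
  rw [realInner_add_left, realInner_comm X (X + Y), realInner_comm Y (X + Y), realInner_add_left,
    realInner_add_left, realInner_comm Y X]
  ring

theorem normSq_smul (c : ℝ) (X : Blocks m n k) : normSq (c • X) = c ^ 2 * normSq X := by
  rw [normSq, realInner_smul_left, realInner_smul_right, normSq]
  ring

/-- The arithmetic-geometric mean inequality for the squared singular values of `k` matrices. -/
theorem mul_prod_rpow_le_normSq (hn : 0 < n) (hk : 0 < k) (A : Blocks m n k) :
    (n * k : ℝ) * (∏ i, ((A i)ᴴ * A i).det.re) ^ (1 / ((n : ℝ) * k)) ≤ normSq A := by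
  have hpsd : ∀ i, ((A i)ᴴ * A i).PosSemidef := fun i =>
    Matrix.posSemidef_conjTranspose_mul_self _
  -- One application to all `nk` eigenvalues at once: only the product of the determinants over the
  -- blocks is controlled, not each determinant.
  have h := Real.geom_mean_le_arith_mean (Finset.univ : Finset (Fin k × Fin n)) (fun _ => 1)
    (fun p => (hpsd p.1).1.eigenvalues p.2) (fun _ _ => zero_le_one)
    (by simp; positivity) (fun p _ => (hpsd p.1).eigenvalues_nonneg p.2)
  have hsum : normSq A = ∑ p : Fin k × Fin n, (hpsd p.1).1.eigenvalues p.2 := by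
    rw [Fintype.sum_prod_type, normSq, realInner]
    refine Finset.sum_congr rfl fun i _ => ?_
    rw [Matrix.trace_mul_comm, (hpsd i).re_trace_eq_sum]
  have hprod : ∏ i, ((A i)ᴴ * A i).det.re =
      ∏ p : Fin k × Fin n, (hpsd p.1).1.eigenvalues p.2 := by
    rw [Fintype.prod_prod_type]
    exact Finset.prod_congr rfl fun i _ => (hpsd i).re_det_eq_prod
  simp only [Real.rpow_one, one_mul, ← hsum, ← hprod, Finset.sum_const, Finset.card_univ,
    Fintype.card_prod, Fintype.card_fin, nsmul_eq_mul, mul_one, Nat.cast_mul] at h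
  rw [le_div_iff₀ (by positivity)] at h
  rw [one_div, mul_comm (n : ℝ) k, mul_comm]
  exact h

theorem re_det_conjTranspose_mul_self_mul (H : Matrix (Fin m) (Fin n) ℂ)
    (Y : Matrix (Fin n) (Fin n) ℂ) :
    ((H * Y)ᴴ * (H * Y)).det.re = ‖Y.det‖ ^ 2 * (Hᴴ * H).det.re := by
  have : (H * Y)ᴴ * (H * Y) = Yᴴ * (Hᴴ * H) * Y := by
    simp only [Matrix.conjTranspose_mul, Matrix.mul_assoc]
  rw [this, Matrix.det_mul, Matrix.det_mul, Matrix.det_conjTranspose, mul_right_comm,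
    Complex.star_def, mul_comm (starRingEnd ℂ _), Complex.mul_conj, Complex.normSq_eq_norm_sq]
  exact Complex.re_ofReal_mul _ _

theorem re_det_conjTranspose_mul_self_nonneg (H : Matrix (Fin m) (Fin n) ℂ) :
    0 ≤ (Hᴴ * H).det.re :=
  (Complex.le_def.1 (Matrix.posSemidef_conjTranspose_mul_self H).det_nonneg).1

/-- The received energy of a matrix tuple with `1 ≤ |pdet Y|`. -/
theorem normSq_mul_ge (hn : 0 < n) (hk : 0 < k) (H : Blocks m n k) (Y : Blocks n n k)
    (hY : 1 ≤ ‖pdet Y‖) :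
    (n * k : ℝ) * (∏ i, ((H i)ᴴ * H i).det.re) ^ (1 / ((n : ℝ) * k)) ≤
      normSq (fun i => H i * Y i) := by
  refine le_trans ?_ (mul_prod_rpow_le_normSq hn hk _)
  simp only [re_det_conjTranspose_mul_self_mul, Finset.prod_mul_distrib]
  have h0 : 0 ≤ ∏ i, ((H i)ᴴ * H i).det.re :=
    Finset.prod_nonneg fun i _ => re_det_conjTranspose_mul_self_nonneg _
  have h1 : (1 : ℝ) ≤ ∏ i, ‖(Y i).det‖ ^ 2 := by
    rw [Finset.prod_pow, ← norm_prod]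
    exact one_le_pow₀ hY
  gcongr
  exact le_mul_of_one_le_left h0 h1

/-- The orthogonal projection onto the column space of `H`, when `H` has full column rank. -/
def colProj (H : Matrix (Fin m) (Fin n) ℂ) : Matrix (Fin m) (Fin m) ℂ := H * (Hᴴ * H)⁻¹ * Hᴴ

theorem conjTranspose_colProj (H : Matrix (Fin m) (Fin n) ℂ) : (colProj H)ᴴ = colProj H := by
  simp [colProj, Matrix.conjTranspose_mul, Matrix.conjTranspose_nonsing_inv, Matrix.mul_assoc]

theorem isUnit_det_of_rank {H : Matrix (Fin m) (Fin n) ℂ} (h : H.rank = n) :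
    IsUnit (Hᴴ * H).det := by
  rw [← Matrix.isUnit_iff_isUnit_det, ← Matrix.linearIndependent_cols_iff_isUnit,
    linearIndependent_iff_card_eq_finrank_span, Set.finrank, ← Matrix.rank_eq_finrank_span_cols,
    Matrix.rank_conjTranspose_mul_self, h, Fintype.card_fin]

theorem re_det_pos_of_rank {H : Matrix (Fin m) (Fin n) ℂ} (h : H.rank = n) :
    0 < (Hᴴ * H).det.re := by
  have h0 := (Matrix.posSemidef_conjTranspose_mul_self H).det_nonneg
  have h1 := lt_of_le_of_ne h0 (isUnit_det_of_rank h).ne_zero.symm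
  exact (Complex.lt_def.1 h1).1

theorem colProj_mul {H : Matrix (Fin m) (Fin n) ℂ} (h : H.rank = n) : colProj H * H = H := by
  rw [colProj, Matrix.mul_assoc, Matrix.mul_assoc, Matrix.nonsing_inv_mul _ (isUnit_det_of_rank h),
    Matrix.mul_one]

theorem colProj_mul_self {H : Matrix (Fin m) (Fin n) ℂ} (h : H.rank = n) :
    colProj H * colProj H = colProj H := by
  conv_lhs => rw [colProj.eq_def H, ← Matrix.mul_assoc, ← Matrix.mul_assoc, ← colProj.eq_def H,
    colProj_mul h]
  rfl

/-- The source of the noise energy `n` per column, in place of the number of receive antennas. -/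
theorem trace_colProj {H : Matrix (Fin m) (Fin n) ℂ} (h : H.rank = n) :
    (colProj H).trace = n := by
  rw [colProj, Matrix.mul_assoc, Matrix.trace_mul_comm, Matrix.mul_assoc,
    Matrix.nonsing_inv_mul _ (isUnit_det_of_rank h), Matrix.trace_one, Fintype.card_fin]

/-- If noise `W` moves a received point at least as close to another one at displacement `H D`, then
the component of the noise along the channel has at least half of the length of `H D`. -/
theorem normSq_le_four_mul_of_closer {H : Blocks m n k} (hH : ∀ i, (H i).rank = n)
    (D : Blocks n n k) (W : Blocks m n k)
    (h : normSq (W - fun i => H i * D i) ≤ normSq W) :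
    normSq (fun i => H i * D i) ≤ 4 * normSq (fun i => colProj (H i) * W i) := by
  set A : Blocks m n k := fun i => H i * D i with hA
  set V : Blocks m n k := fun i => colProj (H i) * W i with hV
  -- The columns of `A` lie in the range of the self-adjoint projection, so it can be moved onto
  -- `W`.
  have hinner : realInner W A = realInner V A := by
    simp only [realInner]
    refine Finset.sum_congr rfl fun i _ => ?_
    have h1 : (A i)ᴴ = (A i)ᴴ * colProj (H i) := by
      have : A i = colProj (H i) * A i := by
        rw [hA]
        simp only
        rw [← Matrix.mul_assoc, colProj_mul (hH i)]
      rw [← conjTranspose_colProj, ← Matrix.conjTranspose_mul, ← this]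
    conv_lhs => rw [h1, ← Matrix.mul_assoc, Matrix.trace_mul_comm, ← Matrix.mul_assoc]
  have h2 : normSq (W - A) = normSq W - 2 * realInner V A + normSq A := by
    have : W - A = W + (-1 : ℝ) • A := by rw [neg_one_smul, sub_eq_add_neg]
    rw [this, normSq_add, normSq_smul, realInner_smul_right, hinner]
    ring
  -- With `2⟨V, A⟩ ≥ ‖A‖²` from the hypothesis, this square yields the factor `4`.
  have h3 := normSq_nonneg ((-2 : ℝ) • V + A)
  rw [normSq_add, normSq_smul, realInner_smul_left] at h3
  linarith

/-- The factor `n` is the squared Frobenius norm of the projection. It is not sharp, but serves only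
for second moment bounds that are uniform in the channel. -/
theorem normSq_colProj_mul_le {H : Matrix (Fin m) (Fin n) ℂ} (h : H.rank = n)
    (w : Matrix (Fin m) (Fin l) ℂ) :
    ((colProj H * w) * (colProj H * w)ᴴ).trace.re ≤ (w * wᴴ).trace.re * n := by
  refine (re_trace_mul_conjTranspose_mul_le _ _).trans (le_of_eq ?_)
  rw [conjTranspose_colProj, colProj_mul_self h, trace_colProj h, mul_comm, Complex.natCast_re]

end Frobenius

/-! ### Decoding errors as deterministic events -/

section Errors

variable {nr n k r : ℕ}

theorem output_sub (H : Blocks nr n k) (X X' : Blocks n n k) (W : Blocks nr n k) :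
    (fun i => output H X W i - H i * X' i) = W - fun i => H i * (X' - X) i := by
  funext i
  simp only [output, Pi.sub_apply, Matrix.mul_sub]
  abel

theorem likelihood_eq (H Y : Blocks nr n k) (X : Blocks n n k) :
    likelihood H Y X = (∏ _i : Fin k, ∏ _a : Fin nr, ∏ _b : Fin n, Real.pi⁻¹) *
      Real.exp (-normSq fun i => Y i - H i * X i) := by
  simp only [likelihood, Finset.prod_mul_distrib, normSq_eq, ← Finset.sum_neg_distrib,
    Real.exp_sum, Matrix.sub_apply]

/-- The Gaussian likelihood decreases with the distance, so a competitor in `C` that is at least as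
likely is a point of `Λ` that is at least as close. -/
theorem naiveLatticeError_of_mlError {C Λ : Set (Blocks n n k)} (hC : C ⊆ Λ) {H : Blocks nr n k}
    {X : Blocks n n k} {W : Blocks nr n k} (h : MLError C H X W) : NaiveLatticeError Λ H X W := by
  obtain ⟨X', hX', hne, hle⟩ := h
  refine ⟨X', hC hX', hne, ?_⟩
  rw [likelihood_eq, likelihood_eq] at hle
  have h0 : 0 < ∏ _i : Fin k, ∏ _a : Fin nr, ∏ _b : Fin n, Real.pi⁻¹ := by
    have := Real.pi_pos
    positivity
  have := (mul_le_mul_iff_right₀ h0).1 hle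
  rw [Real.exp_le_exp, neg_le_neg_iff] at this
  exact this

theorem one_le_norm_pdet {L : MatrixLattice n k r} (hL : L.mindet = 1) {Y : Blocks n n k}
    (hY : Y ∈ L.points) (h0 : Y ≠ 0) : 1 ≤ ‖pdet Y‖ := by
  rw [← hL]
  refine csInf_le ⟨0, ?_⟩ ⟨Y, ⟨hY, h0⟩, rfl⟩
  rintro _ ⟨X, -, rfl⟩
  exact norm_nonneg _

/-- A lattice decoding error forces the noise component along the channel to be large. -/
theorem le_normSq_of_naiveLatticeError (hn : 0 < n) (hk : 0 < k) {L : MatrixLattice n k r}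
    (hL : L.mindet = 1) {α : ℝ} {S X : Blocks n n k} (hX : X ∈ L.shifted α S)
    {H : Blocks nr n k} (hH : ∀ i, (H i).rank = n) {W : Blocks nr n k}
    (h : NaiveLatticeError (L.shifted α S) H X W) :
    α ^ 2 * ((n * k : ℝ) * (∏ i, ((H i)ᴴ * H i).det.re) ^ (1 / ((n : ℝ) * k))) ≤
      4 * normSq (fun i => colProj (H i) * W i) := by
  obtain ⟨Y, hY, rfl⟩ := hX
  obtain ⟨_, ⟨Y', hY', rfl⟩, hne, hle⟩ := h
  rw [output_sub, output_sub] at hle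
  have hD : S + α • Y' - (S + α • Y) = α • (Y' - Y) := by
    rw [smul_sub]; abel
  have hZ : Y' - Y ≠ 0 := by
    intro h0
    exact hne (by rw [sub_eq_zero.1 h0])
  have h0 : (W - fun i => H i * ((S + α • Y) - (S + α • Y)) i) = W := by
    ext i a b
    simp
  rw [hD, h0] at hle
  refine le_trans ?_ (normSq_le_four_mul_of_closer hH _ _ hle)
  have : (fun i => H i * (α • (Y' - Y)) i) = α • (fun i => H i * (Y' - Y) i) := by
    funext i
    simp [Matrix.mul_smul]
  rw [this, normSq_smul]
  gcongr
  exact normSq_mul_ge hn hk H _ (one_le_norm_pdet hL (L.points.sub_mem hY' hY) hZ)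

end Errors

/-! ### Measurability of matrix operations -/

section Measurability

variable {α : Type*} [MeasurableSpace α] {m n l k : ℕ}

theorem measurable_matrix_iff {f : α → Matrix (Fin m) (Fin n) ℂ} :
    Measurable f ↔ ∀ a b, Measurable fun x => f x a b := by
  refine (measurable_pi_iff (X := fun _ : Fin m => Fin n → ℂ)).trans ?_
  exact forall_congr' fun a => measurable_pi_iff

theorem measurable_matrix_mul {f : α → Matrix (Fin m) (Fin n) ℂ}
    {g : α → Matrix (Fin n) (Fin l) ℂ} (hf : Measurable f) (hg : Measurable g) :
    Measurable fun x => f x * g x := by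
  rw [measurable_matrix_iff] at *
  intro a b
  simp only [Matrix.mul_apply]
  exact Finset.measurable_sum _ fun j _ => (hf a j).mul (hg j b)

theorem measurable_conjTranspose {f : α → Matrix (Fin m) (Fin n) ℂ} (hf : Measurable f) :
    Measurable fun x => (f x)ᴴ := by
  rw [measurable_matrix_iff] at *
  intro a b
  simp only [Matrix.conjTranspose_apply]
  exact Complex.continuous_conj.measurable.comp (hf b a)

theorem measurable_det {f : α → Matrix (Fin n) (Fin n) ℂ} (hf : Measurable f) :
    Measurable fun x => (f x).det := by
  rw [measurable_matrix_iff] at hf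
  simp only [Matrix.det_apply']
  exact Finset.measurable_sum _ fun σ _ =>
    (Finset.measurable_prod _ fun i _ => hf _ _).const_mul _

/-- Cramer's rule with the total inverse on `ℂ`; singular matrices need no separate treatment. -/
theorem measurable_matrix_inv {f : α → Matrix (Fin n) (Fin n) ℂ} (hf : Measurable f) :
    Measurable fun x => (f x)⁻¹ := by
  rw [measurable_matrix_iff]
  intro a b
  simp only [Matrix.inv_def, Matrix.smul_apply, Ring.inverse_eq_inv', smul_eq_mul,
    Matrix.adjugate_apply]
  refine (measurable_det hf).inv.mul (measurable_det ?_)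
  rw [measurable_matrix_iff] at *
  intro c d
  simp only [Matrix.updateRow_apply]
  split_ifs
  · exact measurable_const
  · exact hf c d

theorem measurable_colProj {f : α → Matrix (Fin m) (Fin n) ℂ} (hf : Measurable f) :
    Measurable fun x => colProj (f x) :=
  measurable_matrix_mul (measurable_matrix_mul hf
    (measurable_matrix_inv (measurable_matrix_mul (measurable_conjTranspose hf) hf)))
    (measurable_conjTranspose hf)

theorem measurable_re_trace_mul_conjTranspose {f : α → Matrix (Fin m) (Fin n) ℂ}
    (hf : Measurable f) : Measurable fun x => (f x * (f x)ᴴ).trace.re := by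
  rw [measurable_matrix_iff] at hf
  simp only [re_trace_mul_conjTranspose]
  exact Finset.measurable_sum _ fun a _ => Finset.measurable_sum _ fun b _ =>
    (hf a b).norm.pow_const 2

theorem measurable_normSq {f : α → Blocks m n k} (hf : ∀ i, Measurable fun x => f x i) :
    Measurable fun x => normSq (f x) := by
  unfold normSq realInner
  exact Finset.measurable_sum _ fun i _ => measurable_re_trace_mul_conjTranspose (hf i)

end Measurability

/-! ### Moments of complex Gaussian variables -/

section Gaussian

variable {Ω : Type*} [MeasurableSpace Ω] {μ : Measure Ω}

theorem measurable_complexMk : Measurable fun p : ℝ × ℝ => (⟨p.1, p.2⟩ : ℂ) :=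
  Complex.measurableEquivRealProd.symm.measurable

theorem map_re_complexGaussian :
    complexGaussian.map Complex.re = gaussianReal 0 (1 / 2) := by
  rw [complexGaussian, Measure.map_map Complex.measurable_re measurable_complexMk]
  exact Measure.map_fst_prod.trans (by simp)

theorem map_im_complexGaussian :
    complexGaussian.map Complex.im = gaussianReal 0 (1 / 2) := by
  rw [complexGaussian, Measure.map_map Complex.measurable_im measurable_complexMk]
  exact Measure.map_snd_prod.trans (by simp)

theorem memLp_complexGaussian (p : NNReal) : MemLp _root_.id p complexGaussian := by
  have hre : MemLp Complex.re p complexGaussian := by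
    have h := memLp_id_gaussianReal (μ := 0) (v := 1 / 2) p
    rw [← map_re_complexGaussian] at h
    exact (memLp_map_measure_iff aestronglyMeasurable_id
      Complex.measurable_re.aemeasurable).1 h
  have him : MemLp Complex.im p complexGaussian := by
    have h := memLp_id_gaussianReal (μ := 0) (v := 1 / 2) p
    rw [← map_im_complexGaussian] at h
    exact (memLp_map_measure_iff aestronglyMeasurable_id
      Complex.measurable_im.aemeasurable).1 h
  have h : MemLp (fun z => ‖Complex.re z‖ + ‖Complex.im z‖) p complexGaussian :=
    hre.norm.add him.norm
  refine h.mono aestronglyMeasurable_id (Eventually.of_forall fun z => ?_)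
  refine (Complex.norm_le_abs_re_add_abs_im z).trans (le_abs_self _)

instance : IsProbabilityMeasure complexGaussian :=
  Measure.isProbabilityMeasure_map measurable_complexMk.aemeasurable

theorem integral_re_complexGaussian : ∫ z, z.re ∂complexGaussian = 0 := by
  have := integral_map (μ := complexGaussian) Complex.measurable_re.aemeasurable
    (f := fun x : ℝ => x) aestronglyMeasurable_id
  rw [← this, map_re_complexGaussian, integral_id_gaussianReal]

theorem integral_im_complexGaussian : ∫ z, z.im ∂complexGaussian = 0 := by
  have := integral_map (μ := complexGaussian) Complex.measurable_im.aemeasurable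
    (f := fun x : ℝ => x) aestronglyMeasurable_id
  rw [← this, map_im_complexGaussian, integral_id_gaussianReal]

theorem integral_sq_gaussianReal_half : ∫ x, x ^ 2 ∂gaussianReal 0 (1 / 2) = 1 / 2 := by
  have h := variance_id_gaussianReal (μ := 0) (v := 1 / 2)
  rw [variance_eq_integral aemeasurable_id] at h
  simpa [integral_id_gaussianReal] using h

theorem integral_id_complexGaussian : ∫ z, z ∂complexGaussian = 0 := by
  have hi : Integrable (fun z : ℂ => z) complexGaussian :=
    memLp_one_iff_integrable.1 (by exact_mod_cast memLp_complexGaussian 1)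
  apply Complex.ext
  · have := integral_re hi
    simp only [RCLike.re_to_complex] at this
    rw [← this, integral_re_complexGaussian, Complex.zero_re]
  · have := integral_im hi
    simp only [RCLike.im_to_complex] at this
    rw [← this, integral_im_complexGaussian, Complex.zero_im]

theorem integral_norm_sq_complexGaussian : ∫ z, ‖z‖ ^ 2 ∂complexGaussian = 1 := by
  have h1 : ∫ z, z.re ^ 2 ∂complexGaussian = 1 / 2 := by
    rw [← integral_sq_gaussianReal_half, ← map_re_complexGaussian,
      integral_map Complex.measurable_re.aemeasurable (by fun_prop)]
  have h2 : ∫ z, z.im ^ 2 ∂complexGaussian = 1 / 2 := by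
    rw [← integral_sq_gaussianReal_half, ← map_im_complexGaussian,
      integral_map Complex.measurable_im.aemeasurable (by fun_prop)]
  have hm : MemLp _root_.id 2 complexGaussian := by exact_mod_cast memLp_complexGaussian 2
  have hi1 : Integrable (fun z : ℂ => z.re ^ 2) complexGaussian := hm.re.integrable_sq
  have hi2 : Integrable (fun z : ℂ => z.im ^ 2) complexGaussian := hm.im.integrable_sq
  have : ∀ z : ℂ, ‖z‖ ^ 2 = z.re ^ 2 + z.im ^ 2 := fun z => by
    rw [← Complex.normSq_eq_norm_sq, Complex.normSq_apply]; ring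
  simp only [this]
  rw [integral_add hi1 hi2, h1, h2]
  norm_num

/-- The fourth moment of a standard circularly symmetric complex Gaussian variable. -/
def fourthMoment : ℝ := ∫ z, ‖z‖ ^ 4 ∂complexGaussian

variable {w : Ω → ℂ}

theorem memLp_of_complexGaussian (hw : Measurable w) (h : μ.map w = complexGaussian) (p : NNReal) :
    MemLp w p μ := by
  have := memLp_complexGaussian p
  rw [← h] at this
  exact (memLp_map_measure_iff aestronglyMeasurable_id hw.aemeasurable).1 this

theorem integrable_norm_pow_of_complexGaussian [IsFiniteMeasure μ] (hw : Measurable w)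
    (h : μ.map w = complexGaussian) (p : ℕ) :
    Integrable (fun ω => ‖w ω‖ ^ p) μ := by
  have := memLp_of_complexGaussian hw h (p : NNReal)
  exact (show MemLp w (p : ℕ) μ by exact_mod_cast this).integrable_norm_pow'

theorem integral_of_complexGaussian (hw : Measurable w) (h : μ.map w = complexGaussian) :
    ∫ ω, w ω ∂μ = 0 := by
  rw [← integral_id_complexGaussian, ← h]
  exact (integral_map hw.aemeasurable aestronglyMeasurable_id).symm

theorem integral_norm_sq_of_complexGaussian (hw : Measurable w) (h : μ.map w = complexGaussian) :
    ∫ ω, ‖w ω‖ ^ 2 ∂μ = 1 := by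
  rw [← integral_norm_sq_complexGaussian, ← h,
    integral_map hw.aemeasurable (by fun_prop)]

theorem integral_norm_pow_four_of_complexGaussian (hw : Measurable w)
    (h : μ.map w = complexGaussian) : ∫ ω, ‖w ω‖ ^ 4 ∂μ = fourthMoment := by
  rw [fourthMoment, ← h, integral_map hw.aemeasurable (by fun_prop)]

/-- The second moment of a linear combination of independent standard complex Gaussians. -/
theorem integral_norm_sum_sq [IsProbabilityMeasure μ] {m : ℕ} {v : Fin m → Ω → ℂ}
    (hm : ∀ j, Measurable (v j)) (hl : ∀ j, μ.map (v j) = complexGaussian)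
    (hind : Pairwise fun i j => IndepFun (v i) (v j) μ) (c : Fin m → ℂ) :
    ∫ ω, ‖∑ j, c j * v j ω‖ ^ 2 ∂μ = ∑ j, ‖c j‖ ^ 2 := by
  have hL2 : ∀ j, MemLp (v j) 2 μ := fun j => by
    exact_mod_cast memLp_of_complexGaussian (hm j) (hl j) 2
  -- The variables are orthonormal in complex `L²`: unit variance on the diagonal, independence and
  -- zero mean off it.
  have hcross : ∀ j l, ∫ ω, v j ω * (starRingEnd ℂ) (v l ω) ∂μ = if j = l then 1 else 0 := by
    intro j l
    split_ifs with hjl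
    · subst hjl
      have : ∀ ω, v j ω * (starRingEnd ℂ) (v j ω) = ((‖v j ω‖ ^ 2 : ℝ) : ℂ) := fun ω => by
        rw [Complex.mul_conj, Complex.normSq_eq_norm_sq]
      simp only [this]
      rw [integral_complex_ofReal, integral_norm_sq_of_complexGaussian (hm j) (hl j)]
      simp
    · have hi : IndepFun (v j) (fun ω => (starRingEnd ℂ) (v l ω)) μ :=
        (hind hjl).comp measurable_id Complex.continuous_conj.measurable
      rw [hi.integral_fun_mul_eq_mul_integral (hm j).aestronglyMeasurable
        (Complex.continuous_conj.measurable.comp (hm l)).aestronglyMeasurable,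
        integral_of_complexGaussian (hm j) (hl j), zero_mul]
  have hint : ∀ j l, Integrable (fun ω => v j ω * (starRingEnd ℂ) (v l ω)) μ := by
    intro j l
    exact (hL2 j).integrable_mul (hL2 l).star
  have hexp : ∀ ω, ‖∑ j, c j * v j ω‖ ^ 2 =
      (∑ j, ∑ l, c j * (starRingEnd ℂ) (c l) * (v j ω * (starRingEnd ℂ) (v l ω))).re := by
    intro ω
    rw [← Complex.ofReal_re (‖∑ j, c j * v j ω‖ ^ 2), ← Complex.normSq_eq_norm_sq,
      ← Complex.mul_conj, map_sum, Finset.sum_mul_sum]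
    congr 1
    refine Finset.sum_congr rfl fun j _ => Finset.sum_congr rfl fun l _ => ?_
    rw [map_mul]
    ring
  simp only [hexp]
  have hint2 : ∀ j, Integrable (fun ω => ∑ l, c j * (starRingEnd ℂ) (c l) *
      (v j ω * (starRingEnd ℂ) (v l ω))) μ := fun j =>
    integrable_finsetSum _ fun l _ => (hint j l).const_mul _
  have := integral_re (integrable_finsetSum Finset.univ fun j _ => hint2 j)
  simp only [RCLike.re_to_complex] at this
  rw [this, integral_finsetSum _ fun j _ => hint2 j]
  simp only [integral_finsetSum _ fun l _ => (hint _ l).const_mul _, integral_const_mul, hcross]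
  simp only [mul_ite, mul_one, mul_zero, Finset.sum_ite_eq, Finset.mem_univ, if_true,
    Complex.re_sum, Complex.mul_conj, Complex.ofReal_re, Complex.normSq_eq_norm_sq]

end Gaussian

/-! ### Concentration of the projected noise energy -/

section Noise

variable {Ω : Type*} [MeasurableSpace Ω] {μ : Measure Ω} {nr n k : ℕ}
  {W : ℕ → Ω → Matrix (Fin nr) (Fin n) ℂ}

theorem IsWhiteNoise.measurable_apply (hW : IsWhiteNoise μ W) (j : ℕ) (a : Fin nr) (b : Fin n) :
    Measurable fun ω => W j ω a b := measurable_matrix_iff.1 (hW.measurable j) a b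

/-- Functions of distinct noise blocks are independent. -/
theorem IsWhiteNoise.indepFun (hW : IsWhiteNoise μ W) {i j : ℕ} (hij : i ≠ j)
    {f g : Matrix (Fin nr) (Fin n) ℂ → ℝ} (hf : Measurable f) (hg : Measurable g) :
    IndepFun (fun ω => f (W i ω)) (fun ω => g (W j ω)) μ := by
  have h := hW.indep.indepFun_finset (({i} : Finset ℕ) ×ˢ (Finset.univ : Finset (Fin nr × Fin n)))
    (({j} : Finset ℕ) ×ˢ (Finset.univ : Finset (Fin nr × Fin n)))
    (by
      rw [Finset.disjoint_left]
      rintro ⟨a, b⟩ h1 h2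
      simp only [Finset.mem_product, Finset.mem_singleton, Finset.mem_univ, and_true] at h1 h2
      exact hij (h1.symm.trans h2)) (fun p => hW.measurable_apply p.1 p.2.1 p.2.2)
  have key : ∀ i : ℕ, Measurable fun (x : (({i} : Finset ℕ) ×ˢ
      (Finset.univ : Finset (Fin nr × Fin n)) : Finset _) → ℂ) =>
      (fun a b => x ⟨(i, a, b), by simp⟩ : Matrix (Fin nr) (Fin n) ℂ) := by
    intro i
    exact measurable_pi_iff.2 fun a => measurable_pi_iff.2 fun b => measurable_pi_apply _
  exact h.comp (hf.comp (key i)) (hg.comp (key j))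

/-- The energy of a noise block `w` along the column space of `h`. -/
def projEnergy (h w : Matrix (Fin nr) (Fin n) ℂ) : ℝ :=
  ((colProj h * w) * (colProj h * w)ᴴ).trace.re

theorem projEnergy_nonneg (h w : Matrix (Fin nr) (Fin n) ℂ) : 0 ≤ projEnergy h w := by
  rw [projEnergy, re_trace_mul_conjTranspose]
  positivity

theorem measurable_projEnergy (h : Matrix (Fin nr) (Fin n) ℂ) : Measurable (projEnergy h) :=
  measurable_re_trace_mul_conjTranspose (measurable_matrix_mul measurable_const measurable_id)

variable [IsProbabilityMeasure μ]

/-- Each of the `n` columns of the noise contributes the squared Frobenius norm of the projection,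
which is its trace `n`. -/
theorem IsWhiteNoise.integral_projEnergy (hW : IsWhiteNoise μ W) (j : ℕ)
    {h : Matrix (Fin nr) (Fin n) ℂ} (hh : h.rank = n) :
    ∫ ω, projEnergy h (W j ω) ∂μ = (n : ℝ) ^ 2 := by
  simp only [projEnergy, re_trace_mul_conjTranspose, Matrix.mul_apply]
  have hind : ∀ b : Fin n, Pairwise fun i l : Fin nr =>
      IndepFun (fun ω => W j ω i b) (fun ω => W j ω l b) μ := by
    intro b i l hil
    exact hW.indep.indepFun (i := (j, i, b)) (j := (j, l, b)) (by simpa using hil)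
  have hmem : ∀ (a : Fin nr) (b : Fin n),
      Integrable (fun ω => ‖∑ l, colProj h a l * W j ω l b‖ ^ 2) μ := by
    intro a b
    have : MemLp (fun ω => ∑ l, colProj h a l * W j ω l b) 2 μ :=
      memLp_finsetSum _ fun l _ => MemLp.const_mul (by
        exact_mod_cast memLp_of_complexGaussian (hW.measurable_apply j l b) (hW.law j l b) 2) _
    exact this.integrable_norm_pow'
  rw [integral_finsetSum _ fun a _ => integrable_finsetSum _ fun b _ => hmem a b]
  simp only [integral_finsetSum _ fun b _ => hmem _ b,
    integral_norm_sum_sq (fun l => hW.measurable_apply j l _) (fun l => hW.law j l _) (hind _),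
    Finset.sum_const, Finset.card_univ, Fintype.card_fin, nsmul_eq_mul, ← Finset.mul_sum]
  rw [← re_trace_mul_conjTranspose, conjTranspose_colProj, colProj_mul_self hh, trace_colProj hh,
    Complex.natCast_re, sq]

/-- A bound on the variance of the noise energy, uniform in the channel. -/
def energyVar (nr n : ℕ) : ℝ := (n : ℝ) ^ 2 * ((nr * n : ℕ) * (nr * n : ℕ) * fourthMoment)

/-- Cauchy-Schwarz over the `nr * n` entries reduces the squared energy to fourth moments of single
entries. -/
theorem IsWhiteNoise.integrable_sq_energy (hW : IsWhiteNoise μ W) (j : ℕ) :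
    Integrable (fun ω => (W j ω * (W j ω)ᴴ).trace.re ^ 2) μ ∧
    ∫ ω, (W j ω * (W j ω)ᴴ).trace.re ^ 2 ∂μ ≤ (nr * n : ℕ) * (nr * n : ℕ) * fourthMoment := by
  have hle : ∀ ω, (W j ω * (W j ω)ᴴ).trace.re ^ 2 ≤
      (nr * n : ℕ) * ∑ p : Fin nr × Fin n, ‖W j ω p.1 p.2‖ ^ 4 := by
    intro ω
    rw [re_trace_mul_conjTranspose, ← Fintype.sum_prod_type']
    refine sq_sum_le_card_mul_sum_sq.trans (le_of_eq ?_)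
    simp [← pow_mul]
  have hi : Integrable (fun ω => ((nr * n : ℕ) : ℝ) * ∑ p : Fin nr × Fin n, ‖W j ω p.1 p.2‖ ^ 4) μ :=
    (integrable_finsetSum _ fun p _ => integrable_norm_pow_of_complexGaussian
      (hW.measurable_apply j p.1 p.2) (hW.law j p.1 p.2) 4).const_mul _
  have hi' : Integrable (fun ω => (W j ω * (W j ω)ᴴ).trace.re ^ 2) μ := by
    refine hi.mono' ((measurable_re_trace_mul_conjTranspose
      (hW.measurable j)).pow_const 2).aestronglyMeasurable (Eventually.of_forall fun ω => ?_)
    rw [Real.norm_of_nonneg (sq_nonneg _)]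
    exact hle ω
  refine ⟨hi', (integral_mono hi' hi hle).trans (le_of_eq ?_)⟩
  rw [integral_const_mul, integral_finsetSum _ fun p _ => integrable_norm_pow_of_complexGaussian
      (hW.measurable_apply j p.1 p.2) (hW.law j p.1 p.2) 4]
  simp only [integral_norm_pow_four_of_complexGaussian (hW.measurable_apply j _ _) (hW.law j _ _),
    Finset.sum_const, Finset.card_univ, Fintype.card_prod, Fintype.card_fin, nsmul_eq_mul]
  ring

theorem IsWhiteNoise.memLp_projEnergy (hW : IsWhiteNoise μ W) (j : ℕ)
    {h : Matrix (Fin nr) (Fin n) ℂ} (hh : h.rank = n) :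
    MemLp (fun ω => projEnergy h (W j ω)) 2 μ := by
  refine (memLp_two_iff_integrable_sq
    ((measurable_projEnergy h).comp (hW.measurable j)).aestronglyMeasurable).2 ?_
  refine ((hW.integrable_sq_energy j).1.const_mul ((n : ℝ) ^ 2)).mono'
    (((measurable_projEnergy h).comp (hW.measurable j)).pow_const 2).aestronglyMeasurable
    (Eventually.of_forall fun ω => ?_)
  rw [Real.norm_of_nonneg (sq_nonneg _), ← mul_pow, mul_comm]
  exact pow_le_pow_left₀ (projEnergy_nonneg _ _) (normSq_colProj_mul_le hh _) 2

theorem IsWhiteNoise.variance_projEnergy_le (hW : IsWhiteNoise μ W) (j : ℕ)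
    {h : Matrix (Fin nr) (Fin n) ℂ} (hh : h.rank = n) :
    Var[fun ω => projEnergy h (W j ω); μ] ≤ energyVar nr n := by
  refine (variance_le_expectation_sq ((measurable_projEnergy h).comp
    (hW.measurable j)).aestronglyMeasurable).trans ?_
  have h1 := (hW.memLp_projEnergy j hh).integrable_sq
  have h2 := hW.integrable_sq_energy j
  calc ∫ ω, (projEnergy h (W j ω)) ^ 2 ∂μ
      ≤ ∫ ω, (n : ℝ) ^ 2 * (W j ω * (W j ω)ᴴ).trace.re ^ 2 ∂μ := by
        refine integral_mono h1 (h2.1.const_mul _) fun ω => ?_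
        simp only
        rw [← mul_pow, mul_comm]
        exact pow_le_pow_left₀ (projEnergy_nonneg _ _) (normSq_colProj_mul_le hh _) 2
    _ ≤ _ := by
        rw [integral_const_mul, energyVar]
        exact mul_le_mul_of_nonneg_left h2.2 (by positivity)

/-- Concentration of the noise energy along a fixed full rank channel. -/
theorem IsWhiteNoise.measure_le_of_rank (hW : IsWhiteNoise μ W) {h : Blocks nr n k}
    (hh : ∀ i, (h i).rank = n) (hn : 0 < n) (hk : 0 < k) {ε : ℝ} (hε : 0 < ε) :
    μ {ω | (n : ℝ) ^ 2 * k * (1 + ε) ≤ normSq (fun i => colProj (h i) * firstBlocks W k ω i)} ≤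
      ENNReal.ofReal (k * energyVar nr n / ((n : ℝ) ^ 2 * k * ε) ^ 2) := by
  -- The index is `i + 1` because `firstBlocks` numbers the blocks from `1`.
  set Z : Fin k → Ω → ℝ := fun i ω => projEnergy (h i) (W (i + 1) ω) with hZ
  have hsum : ∀ ω, normSq (fun i => colProj (h i) * firstBlocks W k ω i) = (∑ i, Z i) ω := by
    intro ω
    rw [Finset.sum_apply]
    rfl
  have hmem : ∀ i, MemLp (Z i) 2 μ := fun i => hW.memLp_projEnergy _ (hh i)
  have hint : ∫ ω, (∑ i, Z i) ω ∂μ = (n : ℝ) ^ 2 * k := by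
    simp only [Finset.sum_apply]
    rw [integral_finsetSum _ fun i _ => (hmem i).integrable (by norm_num)]
    simp only [hZ, hW.integral_projEnergy _ (hh _), Finset.sum_const, Finset.card_univ,
      Fintype.card_fin, nsmul_eq_mul, mul_comm]
  have hvar : Var[∑ i, Z i; μ] ≤ k * energyVar nr n := by
    rw [IndepFun.variance_sum fun i _ => hmem i]
    · refine (Finset.sum_le_card_nsmul _ _ (energyVar nr n) fun i _ =>
        hW.variance_projEnergy_le _ (hh i)).trans (by simp)
    · intro i _ j _ hij
      exact hW.indepFun (by simpa [Fin.val_inj] using hij) (measurable_projEnergy _)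
        (measurable_projEnergy _)
  have hpos : 0 < (n : ℝ) ^ 2 * k * ε := by positivity
  -- Chebyshev's inequality with deviation `n² k ε` from the mean `n² k`.
  refine le_trans (measure_mono ?_) ((meas_ge_le_variance_div_sq
    (memLp_finsetSum' Finset.univ fun i _ => hmem i) hpos).trans
    (ENNReal.ofReal_le_ofReal (by gcongr)))
  intro ω hω
  simp only [Set.mem_ofPred_eq, hsum] at hω ⊢
  rw [hint]
  refine le_trans ?_ (le_abs_self _)
  linarith

/-- Concentration of the noise energy along an independent channel of full rank. -/
theorem IsWhiteNoise.measure_le {𝓘 : Type*} [AddMonoidWithOne 𝓘]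
    {H : 𝓘 → Ω → Matrix (Fin nr) (Fin n) ℂ} (hW : IsWhiteNoise μ W)
    (hH_meas : ∀ i, Measurable (H i)) (hH_rank : ∀ i, ∀ᵐ ω ∂μ, (H i ω).rank = n)
    (hHW : IndepFun (fun ω i => H i ω) (fun ω j => W j ω) μ)
    (hn : 0 < n) (hk : 0 < k) {ε : ℝ} (hε : 0 < ε) :
    μ {ω | (n : ℝ) ^ 2 * k * (1 + ε) ≤
      normSq (fun i => colProj (firstBlocks H k ω i) * firstBlocks W k ω i)} ≤
      ENNReal.ofReal (k * energyVar nr n / ((n : ℝ) ^ 2 * k * ε) ^ 2) := by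
  have hHm : Measurable (firstBlocks H k) := measurable_pi_iff.2 fun i => hH_meas _
  have hWm : Measurable (firstBlocks W k) := measurable_pi_iff.2 fun i => hW.measurable _
  have hind : IndepFun (firstBlocks H k) (firstBlocks W k) μ :=
    hHW.comp (φ := fun (x : 𝓘 → Matrix (Fin nr) (Fin n) ℂ) (i : Fin k) =>
        x (((i : ℕ) + 1 : ℕ) : 𝓘))
      (ψ := fun (x : ℕ → Matrix (Fin nr) (Fin n) ℂ) (i : Fin k) => x (((i : ℕ) + 1 : ℕ) : ℕ))
      (measurable_pi_iff.2 fun i => measurable_pi_apply _)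
      (measurable_pi_iff.2 fun i => measurable_pi_apply _)
  rw [indepFun_iff_map_prod_eq_prod_map_map hHm.aemeasurable hWm.aemeasurable] at hind
  set E : Set (Blocks nr n k × Blocks nr n k) :=
    {p | (n : ℝ) ^ 2 * k * (1 + ε) ≤ normSq (fun i => colProj (p.1 i) * p.2 i)} with hE
  have hEm : MeasurableSet E := by
    refine measurableSet_le measurable_const (measurable_normSq fun i => ?_)
    exact measurable_matrix_mul
      (measurable_colProj ((measurable_pi_apply i).comp measurable_fst))
      ((measurable_pi_apply i).comp measurable_snd)
  have h1 : μ {ω | (n : ℝ) ^ 2 * k * (1 + ε) ≤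
      normSq (fun i => colProj (firstBlocks H k ω i) * firstBlocks W k ω i)} =
      (μ.map fun ω => (firstBlocks H k ω, firstBlocks W k ω)) E := by
    rw [Measure.map_apply (hHm.prodMk hWm) hEm]
    rfl
  rw [h1, hind]
  have : IsProbabilityMeasure (μ.map (firstBlocks H k)) :=
    Measure.isProbabilityMeasure_map hHm.aemeasurable
  have : IsProbabilityMeasure (μ.map (firstBlocks W k)) :=
    Measure.isProbabilityMeasure_map hWm.aemeasurable
  -- Independence makes the joint law a product, so the channel can be frozen; the bound for a
  -- frozen channel does not depend on it.
  rw [Measure.prod_apply hEm, lintegral_map (measurable_measure_prodMk_left hEm) hHm]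
  have hrank : ∀ᵐ ω ∂μ, ∀ i : Fin k, (firstBlocks H k ω i).rank = n :=
    ae_all_iff.2 fun i => hH_rank _
  calc _ ≤ ∫⁻ _, ENNReal.ofReal (k * energyVar nr n / ((n : ℝ) ^ 2 * k * ε) ^ 2) ∂μ := by
        refine lintegral_mono_ae ?_
        filter_upwards [hrank] with ω hω
        rw [Measure.map_apply hWm (measurable_prodMk_left hEm)]
        exact hW.measure_le_of_rank hω hn hk hε
    _ = _ := by simp

end Noise

/-! ### Counting lattice points in translates -/

section Lattice

variable {E κ : Type*} [NormedAddCommGroup E] [MeasurableSpace E] [BorelSpace E] [Fintype κ]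

/-- Some translate of a lattice has at least as many points in a bounded measurable set as the
volume ratio predicts. -/
theorem exists_measure_le_ncard_mul [NormedSpace ℝ E] [FiniteDimensional ℝ E]
    (ν : Measure E) [ν.IsAddHaarMeasure] (b : Module.Basis κ ℝ E)
    {t : Set E} (ht : MeasurableSet t) (hb : Bornology.IsBounded t) :
    ∃ S : E, ν t ≤ ((t ∩ {x | ∃ v ∈ (Submodule.span ℤ (Set.range b)).toAddSubgroup, x = S + v}).ncard : ℝ≥0∞) *
      ν (ZSpan.fundamentalDomain b) := by
  classical
  set Λ := (Submodule.span ℤ (Set.range b)).toAddSubgroup with hΛ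
  have hfd := ZSpan.isAddFundamentalDomain' b ν
  set F := ZSpan.fundamentalDomain b with hF
  have : Countable Λ := inferInstanceAs (Countable (Submodule.span ℤ (Set.range b)))
  have hcount : ∀ x, (∑' g : Λ, t.indicator (1 : E → ℝ≥0∞) (g +ᵥ x)) =
      (t ∩ {y | ∃ v ∈ Λ, y = x + v}).encard := by
    intro x
    set A : Set Λ := {g : Λ | g +ᵥ x ∈ t} with hA
    have h1 : ∀ g : Λ, t.indicator (1 : E → ℝ≥0∞) (g +ᵥ x) = A.indicator 1 g := by
      intro g
      simp [Set.indicator_apply, hA]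
    simp only [h1]
    rw [← tsum_subtype A (1 : Λ → ℝ≥0∞)]
    simp only [Pi.one_apply, ENNReal.tsum_set_one]
    have himg : (fun g : Λ => g +ᵥ x) '' A = t ∩ {y | ∃ v ∈ Λ, y = x + v} := by
      ext y
      constructor
      · rintro ⟨g, hg, rfl⟩
        exact ⟨hg, g, g.2, by simp [AddSubgroup.vadd_def, add_comm]⟩
      · rintro ⟨hy, v, hv, rfl⟩
        refine ⟨⟨v, hv⟩, ?_, by simp [AddSubgroup.vadd_def, add_comm]⟩
        simpa [hA, AddSubgroup.vadd_def, add_comm] using hy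
    rw [← himg, Set.InjOn.encard_image]
    intro g _ g' _ hgg
    simpa [AddSubgroup.vadd_def] using hgg
  -- Unfolding: the lattice translates of `F` tile the space, so the count integrated over `F` is
  -- the measure of `t`. Some `x` attains at least the average count.
  have hint : ∫⁻ x in F, (∑' g : Λ, t.indicator (1 : E → ℝ≥0∞) (g +ᵥ x)) ∂ν = ν t := by
    rw [lintegral_tsum, ← hfd.lintegral_eq_tsum'', lintegral_indicator_one ht]
    intro g
    exact ((measurable_one.indicator ht).comp (measurable_const_vadd g)).aemeasurable
  have hF0 : ν F ≠ 0 := ZSpan.measure_fundamentalDomain_ne_zero b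
  have hFtop : ν F ≠ ∞ := (ZSpan.fundamentalDomain_isBounded b).measure_lt_top.ne
  obtain ⟨x, -, hx⟩ := exists_setLAverage_le hF0
    (ZSpan.fundamentalDomain_measurableSet b).nullMeasurableSet
    (by rw [hint]; exact hb.measure_lt_top.ne)
  refine ⟨x, ?_⟩
  rw [setLAverage_eq, hint, hcount, ENNReal.div_le_iff hF0 hFtop] at hx
  -- Finiteness is what lets `ncard` replace `encard`.
  have hfin : (t ∩ {y | ∃ v ∈ Λ, y = x + v}).Finite := by
    have hb' : Bornology.IsBounded ((fun y => y - x) '' t) := by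
      obtain ⟨R, hR⟩ := hb.exists_norm_le
      refine isBounded_iff_forall_norm_le.2 ⟨R + ‖x‖, ?_⟩
      rintro _ ⟨y, hy, rfl⟩
      exact (norm_sub_le _ _).trans (by linarith [hR y hy])
    refine ((ZSpan.setFinite_inter b hb').image (fun v => x + v)).subset ?_
    rintro y ⟨hy, v, hv, rfl⟩
    exact ⟨v, ⟨⟨x + v, hy, by simp⟩, hv⟩, rfl⟩
  rw [← hfin.cast_ncard_eq] at hx
  exact_mod_cast hx

/-- The volume of the fundamental domain in terms of the Gram matrix. -/
theorem volume_fundamentalDomain_eq_gram [InnerProductSpace ℝ E] [FiniteDimensional ℝ E]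
    [DecidableEq κ] (b : Module.Basis κ ℝ E) :
    volume (ZSpan.fundamentalDomain b) =
      ENNReal.ofReal √|(Matrix.gram ℝ b).det| := by
  have hcard : Module.finrank ℝ E = Fintype.card κ := Module.finrank_eq_card_basis b
  set o : OrthonormalBasis κ ℝ E := (stdOrthonormalBasis ℝ E).reindex
    ((finCongr hcard).trans (Fintype.equivFin κ).symm) with ho
  rw [ZSpan.measure_fundamentalDomain b volume o.toBasis,
    measure_congr (ZSpan.fundamentalDomain_ae_parallelepiped o.toBasis volume),
    OrthonormalBasis.coe_toBasis, o.volume_parallelepiped, mul_one]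
  congr 1
  have hg := Matrix.gram_eq_conjTranspose_mul o b
  rw [hg, Matrix.det_mul, Matrix.det_conjTranspose, star_trivial, abs_mul_self,
    Real.sqrt_mul_self_eq_abs]
  rfl

end Lattice

/-! ### Real Euclidean coordinates -/

section Coordinates

variable {n k : ℕ}

/-- Real coordinates on the space of matrix tuples, compatible with the inner products. -/
def toEuclidean (n k : ℕ) :
    Blocks n n k ≃ₗ[ℝ] EuclideanSpace ℝ ((Fin k × Fin n × Fin n) × Fin 2) where
  toFun X := WithLp.toLp 2 fun p =>
    ![(X p.1.1 p.1.2.1 p.1.2.2).re, (X p.1.1 p.1.2.1 p.1.2.2).im] p.2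
  invFun y := fun i a b => ⟨y ((i, a, b), 0), y ((i, a, b), 1)⟩
  map_add' X Y := by
    ext ⟨p, q⟩
    fin_cases q <;> simp
  map_smul' c X := by
    ext ⟨p, q⟩
    fin_cases q <;> simp
  left_inv X := by
    funext i
    ext a b
    simp
  right_inv y := by
    ext ⟨⟨i, a, b⟩, q⟩
    fin_cases q <;> simp

theorem toEuclidean_apply (X : Blocks n n k) (p : (Fin k × Fin n × Fin n) × Fin 2) :
    toEuclidean n k X p = ![(X p.1.1 p.1.2.1 p.1.2.2).re, (X p.1.1 p.1.2.1 p.1.2.2).im] p.2 := rfl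

theorem inner_toEuclidean (X Y : Blocks n n k) :
    inner ℝ (toEuclidean n k X) (toEuclidean n k Y) = realInner X Y := by
  simp only [PiLp.inner_apply, toEuclidean_apply,
    Fintype.sum_prod_type, Fin.sum_univ_two, realInner, Matrix.trace, Matrix.diag,
    Matrix.mul_apply, Matrix.conjTranspose_apply, Complex.re_sum]
  refine Finset.sum_congr rfl fun i _ => Finset.sum_congr rfl fun a _ =>
    Finset.sum_congr rfl fun b _ => ?_
  simp [Complex.mul_re]
  ring

theorem norm_toEuclidean_sq (X : Blocks n n k) : ‖toEuclidean n k X‖ ^ 2 = normSq X := by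
  rw [← real_inner_self_eq_norm_sq, inner_toEuclidean, normSq]

theorem card_coordinates (n k : ℕ) :
    Fintype.card ((Fin k × Fin n × Fin n) × Fin 2) = 2 * n ^ 2 * k := by
  simp
  ring

end Coordinates

/-! ### Volume, scaling and the choice of shifts -/

namespace MatrixLattice

variable {n k r : ℕ}

theorem gram_eq (L : MatrixLattice n k r) :
    L.gram = Matrix.gram ℝ (fun j => toEuclidean n k (L.basis j)) := by
  ext i j
  simp [gram, Matrix.gram_apply, inner_toEuclidean]

theorem vol_pos (L : MatrixLattice n k r) : 0 < L.vol := by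
  have : L.gram.det ≠ 0 := by
    rw [gram_eq, Matrix.det_gram_ne_zero_iff_linearIndependent]
    exact L.linearIndependent.map' (toEuclidean n k).toLinearMap (toEuclidean n k).ker
  exact Real.sqrt_pos.2 (abs_pos.2 this)

theorem scaling_sq (L : MatrixLattice n k r) {P : ℝ} (hP : 0 < P) (R : ℝ) :
    L.scaling P R ^ 2 = (((Real.pi * n * k) ^ (n ^ 2 * k) / ((n ^ 2 * k).factorial : ℝ)) ^
        (1 / ((n : ℝ) ^ 2 * k)) * P) /
      ((2 : ℝ) ^ (R / n) * L.vol ^ (1 / ((n : ℝ) ^ 2 * k))) := by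
  have := L.vol_pos
  have := Real.pi_pos
  rw [scaling, Real.sq_sqrt (by positivity)]

theorem scaling_pos (L : MatrixLattice n k r) (hn : 0 < n) (hk : 0 < k) {P : ℝ} (hP : 0 < P)
    (R : ℝ) : 0 < L.scaling P R := by
  have := L.vol_pos
  have := Real.pi_pos
  exact Real.sqrt_pos.2 (by positivity)

/-- The scaling makes the ball of the power constraint `2^{Rnk}` times as large as a cell. -/
theorem scaling_sq_pow_mul (L : MatrixLattice n k r) (hn : 0 < n) (hk : 0 < k) {P : ℝ}
    (hP : 0 < P) (R : ℝ) :
    (2 : ℝ) ^ (R * n * k) * ((L.scaling P R ^ 2) ^ (n ^ 2 * k) * L.vol) =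
      (Real.pi * (P * k * n)) ^ (n ^ 2 * k) / ((n ^ 2 * k).factorial : ℝ) := by
  have hv := L.vol_pos
  have hπ := Real.pi_pos
  have hN : n ^ 2 * k ≠ 0 := by positivity
  have hn' : (n : ℝ) ≠ 0 := by positivity
  have hcast : 1 / ((n : ℝ) ^ 2 * k) = ((n ^ 2 * k : ℕ) : ℝ)⁻¹ := by
    push_cast; rw [one_div]
  rw [L.scaling_sq hP, hcast, div_pow, mul_pow _ P, mul_pow (2 ^ (R / n) : ℝ),
    Real.rpow_inv_natCast_pow (by positivity) hN, Real.rpow_inv_natCast_pow hv.le hN]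
  have h2 : ((2 : ℝ) ^ (R / n)) ^ (n ^ 2 * k) = (2 : ℝ) ^ (R * n * k) := by
    rw [← Real.rpow_natCast, ← Real.rpow_mul (by norm_num)]
    congr 1
    push_cast
    field_simp
  rw [h2]
  have h3 : (0 : ℝ) < 2 ^ (R * n * k) := by positivity
  have h4 : Real.pi * (P * k * n) = (Real.pi * n * k) * P := by ring
  rw [h4, mul_pow _ P]
  field_simp

/-- Shifts for which the spherically shaped code has at least `2^{Rnk}` words. -/
theorem exists_shift (L : MatrixLattice n k (2 * n ^ 2 * k)) (hn : 0 < n) (hk : 0 < k) {P : ℝ}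
    (hP : 0 < P) (R : ℝ) :
    ∃ S : Blocks n n k,
      (2 : ℝ) ^ (R * n * k) ≤ ((L.code P (L.scaling P R) S).ncard : ℝ) := by
  set α := L.scaling P R with hα
  have hα0 : 0 < α := L.scaling_pos hn hk hP R
  set φ := toEuclidean n k with hφ
  have hr : Fintype.card (Fin (2 * n ^ 2 * k)) =
      Module.finrank ℝ (EuclideanSpace ℝ ((Fin k × Fin n × Fin n) × Fin 2)) := by
    rw [finrank_euclideanSpace, card_coordinates, Fintype.card_fin]
  have : Nonempty (Fin (2 * n ^ 2 * k)) := ⟨⟨0, by positivity⟩⟩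
  have : Nonempty ((Fin k × Fin n × Fin n) × Fin 2) := ⟨⟨(⟨0, hk⟩, ⟨0, hn⟩, ⟨0, hn⟩), 0⟩⟩
  have hli : LinearIndependent ℝ (fun j => φ (α • L.basis j)) := by
    have h1 : LinearIndependent ℝ (fun j => φ (L.basis j)) :=
      L.linearIndependent.map' φ.toLinearMap φ.ker
    have h2 := h1.units_smul (fun _ => Units.mk0 α hα0.ne')
    convert h2 using 2 with j
    simp [Units.smul_def]
  set b := basisOfLinearIndependentOfCardEqFinrank hli hr with hb
  have hbj : ∀ j, b j = φ (α • L.basis j) := fun j => by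
    rw [hb, coe_basisOfLinearIndependentOfCardEqFinrank]
  obtain ⟨S, hS⟩ := exists_measure_le_ncard_mul volume b
    (t := Metric.closedBall 0 √(P * k * n)) Metric.isClosed_closedBall.measurableSet
    Metric.isBounded_closedBall
  refine ⟨φ.symm S, ?_⟩
  have hspan : ∀ v, v ∈ (Submodule.span ℤ (Set.range b)).toAddSubgroup ↔ ∃ Y ∈ L.points, v = φ (α • Y) := by
    intro v
    set f : Blocks n n k →+ EuclideanSpace ℝ ((Fin k × Fin n × Fin n) × Fin 2) :=
      (φ.toLinearMap.comp (α • LinearMap.id)).toAddMonoidHom with hf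
    have hfx : ∀ Y, f Y = φ (α • Y) := fun Y => rfl
    have hmap : L.points.map f = (Submodule.span ℤ (Set.range b)).toAddSubgroup := by
      rw [points, AddMonoidHom.map_closure, Submodule.span_int_eq_addSubgroupClosure,
        ← Set.range_comp]
      congr 2
      funext j
      rw [hbj]
      rfl
    rw [← hmap, AddSubgroup.mem_map]
    simp only [hfx, eq_comm]
  have hcode : φ '' (L.code P α (φ.symm S)) = Metric.closedBall 0 √(P * k * n) ∩
      {x | ∃ v ∈ (Submodule.span ℤ (Set.range b)).toAddSubgroup, x = S + v} := by
    have hball : ∀ X, normSq X ≤ P * k * n ↔ φ X ∈ Metric.closedBall 0 √(P * k * n) := by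
      intro X
      rw [mem_closedBall_zero_iff, ← norm_toEuclidean_sq]
      rw [Real.le_sqrt (norm_nonneg _) (by positivity)]
    ext x
    constructor
    · rintro ⟨X, ⟨hX1, Y, hY, rfl⟩, rfl⟩
      refine ⟨(hball _).1 hX1, φ (α • Y), (hspan _).2 ⟨Y, hY, rfl⟩, ?_⟩
      rw [map_add, LinearEquiv.apply_symm_apply]
    · rintro ⟨hx, v, hv, rfl⟩
      obtain ⟨Y, hY, rfl⟩ := (hspan _).1 hv
      have h1 : φ (φ.symm S + α • Y) = S + φ (α • Y) := by
        rw [map_add, LinearEquiv.apply_symm_apply]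
      refine ⟨φ.symm S + α • Y, ⟨(hball _).2 (by rw [h1]; exact hx), Y, hY, rfl⟩, h1⟩
  rw [← hcode, Set.ncard_image_of_injective _ φ.injective, volume_fundamentalDomain_eq_gram,
    EuclideanSpace.volume_closedBall, card_coordinates] at hS
  have hgram : Matrix.gram ℝ b = (α ^ 2) • L.gram := by
    ext i j
    simp only [Matrix.gram_apply, hbj, Matrix.smul_apply, gram, Matrix.of_apply, smul_eq_mul,
      hφ, inner_toEuclidean, realInner_smul_left, realInner_smul_right]
    ring
  have hvol : √|(Matrix.gram ℝ b).det| = (α ^ 2) ^ (n ^ 2 * k) * L.vol := by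
    rw [hgram, Matrix.det_smul, Fintype.card_fin, abs_mul, Real.sqrt_mul (abs_nonneg _), vol]
    congr 1
    -- The Gram determinant scales by `(α²)^(2n²k)`; the even exponent makes its square root a
    -- polynomial in `α²`.
    rw [show 2 * n ^ 2 * k = (n ^ 2 * k) * 2 by ring, pow_mul, abs_pow, sq_abs,
      Real.sqrt_sq (by positivity)]
  have hball : ENNReal.ofReal √(P * k * n) ^ (2 * n ^ 2 * k) *
      ENNReal.ofReal (√Real.pi ^ (2 * n ^ 2 * k) /
        Real.Gamma (((2 * n ^ 2 * k : ℕ) : ℝ) / 2 + 1)) =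
      ENNReal.ofReal ((Real.pi * (P * k * n)) ^ (n ^ 2 * k) / ((n ^ 2 * k).factorial : ℝ)) := by
    -- In even real dimension the Gamma factor of the ball volume is the factorial in the scaling
    -- constant.
    have h2 : ((2 * n ^ 2 * k : ℕ) : ℝ) / 2 + 1 = ((n ^ 2 * k : ℕ) : ℝ) + 1 := by
      push_cast; ring
    rw [h2, Real.Gamma_nat_eq_factorial, ← ENNReal.ofReal_pow (Real.sqrt_nonneg _),
      ← ENNReal.ofReal_mul (by positivity), show 2 * n ^ 2 * k = 2 * (n ^ 2 * k) by ring,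
      pow_mul √Real.pi, pow_mul √(P * k * n), Real.sq_sqrt (by positivity),
      Real.sq_sqrt Real.pi_pos.le, mul_pow Real.pi]
    congr 1
    ring
  rw [hball, hvol, ← L.scaling_sq_pow_mul hn hk hP R, ← ENNReal.ofReal_natCast,
    ← ENNReal.ofReal_mul (by positivity)] at hS
  have hv := L.vol_pos
  have hpos : 0 < (α ^ 2) ^ (n ^ 2 * k) * L.vol := by positivity
  rw [ENNReal.ofReal_le_ofReal_iff (by positivity)] at hS
  exact le_of_mul_le_mul_right hS hpos

end MatrixLattice

/-! ### Stirling asymptotics of the scaling -/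

section Factorial

theorem tendsto_log_factorial_div_sub_log :
    Tendsto (fun N : ℕ => Real.log N.factorial / N - Real.log N) atTop (𝓝 (-1)) := by
  have hst : Tendsto (fun N : ℕ => Real.log (Stirling.stirlingSeq N)) atTop
      (𝓝 (Real.log √Real.pi)) :=
    (Real.continuousAt_log (by positivity)).tendsto.comp
      Stirling.tendsto_stirlingSeq_sqrt_pi
  have hinv : Tendsto (fun N : ℕ => ((N : ℝ))⁻¹) atTop (𝓝 0) := tendsto_inv_atTop_nhds_zero_nat
  have hlog : Tendsto (fun N : ℕ => Real.log (2 * N) / (2 * N)) atTop (𝓝 0) := by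
    have h := Real.isLittleO_log_id_atTop.tendsto_div_nhds_zero
    have h2 : Tendsto (fun N : ℕ => 2 * (N : ℝ)) atTop atTop :=
      tendsto_natCast_atTop_atTop.const_mul_atTop (by norm_num)
    exact h.comp h2
  have h := ((hst.mul hinv).add hlog).sub (tendsto_const_nhds (x := (1 : ℝ)))
  simp only [mul_zero, zero_add, zero_sub] at h
  refine h.congr' ?_
  filter_upwards [eventually_ne_atTop 0] with N hN
  have hN' : (N : ℝ) ≠ 0 := by exact_mod_cast hN
  rw [Stirling.log_stirlingSeq_formula, Real.log_div hN' (Real.exp_ne_zero 1), Real.log_exp]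
  field_simp
  ring

/-- The origin of the factor `e` in the lattice rate. -/
theorem tendsto_div_factorial_rpow :
    Tendsto (fun N : ℕ => (N : ℝ) / (N.factorial : ℝ) ^ ((N : ℝ)⁻¹)) atTop (𝓝 (Real.exp 1)) := by
  have h := (Real.continuous_exp.tendsto _).comp tendsto_log_factorial_div_sub_log.neg
  rw [neg_neg] at h
  refine h.congr' ?_
  filter_upwards [eventually_gt_atTop 0] with N hN
  have hN' : (0 : ℝ) < N := by exact_mod_cast hN
  have hf : (0 : ℝ) < N.factorial := by positivity
  simp only [Function.comp]
  rw [neg_sub, Real.exp_sub, Real.exp_log hN', Real.rpow_def_of_pos hf, div_eq_mul_inv (Real.log _)]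

variable {n k r : ℕ}

/-- Separates the only factor depending on `k`, of the form `N / (N!)^{1/N}`, from a constant
determined by `n`, `P`, `R` and `CL`. -/
theorem MatrixLattice.le_scaling_sq (L : MatrixLattice n k r) (hn : 0 < n) (hk : 0 < k)
    {CL P : ℝ} (hP : 0 < P) (R : ℝ) (hL : L.vol ^ (1 / ((n : ℝ) ^ 2 * k)) ≤ CL) :
    ((n ^ 2 * k : ℕ) : ℝ) / ((n ^ 2 * k).factorial : ℝ) ^ (((n ^ 2 * k : ℕ) : ℝ)⁻¹) *
      (Real.pi / n * P / (2 ^ (R / n) * CL)) ≤ L.scaling P R ^ 2 := by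
  have hv := L.vol_pos
  have hπ := Real.pi_pos
  have hn' : (0 : ℝ) < n := by exact_mod_cast hn
  have hk' : (0 : ℝ) < k := by exact_mod_cast hk
  have hv' : 0 < L.vol ^ (1 / ((n : ℝ) ^ 2 * k)) := by positivity
  have hN : n ^ 2 * k ≠ 0 := by positivity
  have hcast : 1 / ((n : ℝ) ^ 2 * k) = ((n ^ 2 * k : ℕ) : ℝ)⁻¹ := by
    push_cast; rw [one_div]
  have hf : (0 : ℝ) < (n ^ 2 * k).factorial := by positivity
  have hc : 0 ≤ ((n ^ 2 * k : ℕ) : ℝ) /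
    ((n ^ 2 * k).factorial : ℝ) ^ (((n ^ 2 * k : ℕ) : ℝ)⁻¹) := by positivity
  rw [L.scaling_sq hP]
  have h1 : ((Real.pi * n * k) ^ (n ^ 2 * k) / ((n ^ 2 * k).factorial : ℝ)) ^
        (1 / ((n : ℝ) ^ 2 * k)) =
      ((n ^ 2 * k : ℕ) : ℝ) / ((n ^ 2 * k).factorial : ℝ) ^ (((n ^ 2 * k : ℕ) : ℝ)⁻¹) *
        (Real.pi / n) := by
    rw [hcast, Real.div_rpow (by positivity) hf.le, Real.pow_rpow_inv_natCast (by positivity) hN]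
    push_cast
    field_simp
  have hCL : 0 < CL := hv'.trans_le hL
  have h2 : (0 : ℝ) < 2 ^ (R / n) := by positivity
  rw [h1]
  generalize ((n ^ 2 * k : ℕ) : ℝ) / ((n ^ 2 * k).factorial : ℝ) ^ (((n ^ 2 * k : ℕ) : ℝ)⁻¹) = c
    at hc ⊢
  calc c * (Real.pi / n * P / (2 ^ (R / n) * CL)) =
        c * (Real.pi / n) * P / (2 ^ (R / n) * CL) := by ring
    _ ≤ _ := by gcongr

end Factorial

/-! ### The law of large numbers for the fading process -/

section Ergodic

variable {Ω 𝓘 : Type*} [MeasurableSpace Ω] [AddMonoidWithOne 𝓘] {μ : Measure Ω}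
  [IsProbabilityMeasure μ] {nr n : ℕ} {H : 𝓘 → Ω → Matrix (Fin nr) (Fin n) ℂ}

theorem measurable_shift (E : Type*) [MeasurableSpace E] : Measurable (shift 𝓘 E) :=
  measurable_pi_iff.2 fun i => measurable_pi_apply (i + 1)

theorem iterate_shift_one {E : Type*} (x : 𝓘 → E) (j : ℕ) :
    (shift 𝓘 E)^[j] x 1 = x ((j + 1 : ℕ) : 𝓘) := by
  have : ∀ i : 𝓘, (shift 𝓘 E)^[j] x i = x (i + j) := by
    induction j with
    | zero => simp
    | succ j ih =>
      intro i
      rw [Function.iterate_succ_apply', shift, ih, add_assoc]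
      congr 2
      rw [add_comm j 1, Nat.cast_add, Nat.cast_one]
  rw [this, add_comm j 1, Nat.cast_add, Nat.cast_one]

/-- The law of a stationary process is preserved by the shift. -/
theorem IsStationary.measurePreserving (hH_meas : ∀ i, Measurable (H i))
    (hH : IsStationary μ H) :
    MeasurePreserving (shift 𝓘 (Matrix (Fin nr) (Fin n) ℂ)) (μ.map fun ω i => H i ω)
      (μ.map fun ω i => H i ω) := by
  have hHm : Measurable fun ω i => H i ω := measurable_pi_iff.2 hH_meas
  refine ⟨measurable_shift _, ?_⟩
  have : IsProbabilityMeasure (μ.map fun ω i => H i ω) :=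
    Measure.isProbabilityMeasure_map hHm.aemeasurable
  -- The finite-dimensional marginals determine the law of the process; stationarity with `t = 1`
  -- compares them, after each finite index set is enumerated.
  refine IsProjectiveLimit.unique
    (P := fun I : Finset 𝓘 => (μ.map fun ω i => H i ω).map I.restrict) ?_ fun I => rfl
  intro I
  have h := hH 1 I.card fun j => (I.equivFin.symm j : 𝓘)
  rw [Measure.map_map (measurable_shift _) hHm, Measure.map_map I.measurable_restrict
    ((measurable_shift _).comp hHm)]
  refine Eq.trans ?_ (Measure.map_map I.measurable_restrict hHm).symm
  set e : (Fin I.card → Matrix (Fin nr) (Fin n) ℂ) → (I → Matrix (Fin nr) (Fin n) ℂ) :=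
    fun x p => x (I.equivFin p) with he
  have hem : Measurable e := measurable_pi_iff.2 fun p => measurable_pi_apply _
  have h2 := congrArg (Measure.map e) h
  rw [Measure.map_map hem (measurable_pi_iff.2 fun j => hH_meas _),
    Measure.map_map hem (measurable_pi_iff.2 fun j => hH_meas _)] at h2
  have e1 : (e ∘ fun ω (j : Fin I.card) => H (I.equivFin.symm j : 𝓘) ω) =
      I.restrict ∘ fun ω i => H i ω := by
    funext ω p
    simp [he]
  have e2 : (e ∘ fun ω (j : Fin I.card) => H ((I.equivFin.symm j : 𝓘) + ((1 : ℕ) : 𝓘)) ω) =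
      I.restrict ∘ shift 𝓘 (Matrix (Fin nr) (Fin n) ℂ) ∘ fun ω i => H i ω := by
    funext ω p
    simp [he, shift]
  rw [e1, e2] at h2
  exact h2.symm

theorem measurable_logDet {α : Type*} [MeasurableSpace α] (c : ℝ)
    {f : α → Matrix (Fin nr) (Fin n) ℂ} (hf : Measurable f) :
    Measurable fun x => logDet c (f x) := by
  simp only [logDet, Real.logb, Matrix.det_smul]
  refine (Real.measurable_log.comp ?_).div_const _
  exact Complex.measurable_re.comp ((measurable_det (measurable_matrix_mul
    (measurable_conjTranspose hf) hf)).const_mul _)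

/-- The law of large numbers for the log-determinants of a stationary ergodic process. -/
theorem tendsto_measure_logDet_average (hH_meas : ∀ i, Measurable (H i))
    (hH_stat : IsStationary μ H) (hH_erg : IsErgodic μ H)
    (hH_int : Integrable (fun ω => logDet 1 (H 1 ω)) μ) {ε : ℝ} (hε : 0 < ε) :
    Tendsto (fun k : ℕ => μ {ω | ε ≤ |(k : ℝ)⁻¹ * ∑ i, logDet 1 (firstBlocks H k ω i) -
      ∫ ω, logDet 1 (H 1 ω) ∂μ|}) atTop (𝓝 0) := by
  have hHm : Measurable fun ω i => H i ω := measurable_pi_iff.2 hH_meas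
  set ν := μ.map fun ω i => H i ω with hν
  have : IsProbabilityMeasure ν := Measure.isProbabilityMeasure_map hHm.aemeasurable
  have hT : Ergodic (shift 𝓘 (Matrix (Fin nr) (Fin n) ℂ)) ν :=
    ⟨hH_stat.measurePreserving hH_meas, hH_erg⟩
  set f : (𝓘 → Matrix (Fin nr) (Fin n) ℂ) → ℝ := fun x => logDet 1 (x 1) with hf
  have hfm : Measurable f := measurable_logDet 1 (measurable_pi_apply 1)
  have hfi : Integrable f ν :=
    (integrable_map_measure hfm.aestronglyMeasurable hHm.aemeasurable).2 hH_int
  have hint : ∫ x, f x ∂ν = ∫ ω, logDet 1 (H 1 ω) ∂μ :=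
    integral_map hHm.aemeasurable hfm.aestronglyMeasurable
  have h := tendsto_measure_birkhoffAverage hT hfi hε
  refine tendsto_of_tendsto_of_tendsto_of_le_of_le tendsto_const_nhds h (fun _ => zero_le)
    fun k => ?_
  -- Only an upper bound is needed, so the deviation set need not be shown measurable.
  refine le_trans (measure_mono ?_) (Measure.le_map_apply hHm.aemeasurable _)
  intro ω hω
  simp only [Set.mem_ofPred_eq, Set.mem_preimage, hint] at hω ⊢
  rw [Real.norm_eq_abs]
  convert hω using 3
  simp only [birkhoffAverage, birkhoffSum, smul_eq_mul, hf, iterate_shift_one, firstBlocks]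
  rw [← Fin.sum_univ_eq_sum_range (fun j => logDet 1 (H ((j + 1 : ℕ) : 𝓘) ω))]

end Ergodic

/-! ### Bounded gap to the ergodic capacity -/

section Capacity

variable {nr n : ℕ}

theorem exists_eq_mul_conjTranspose {Q : Matrix (Fin n) (Fin n) ℂ} (hQ : Q.PosSemidef) :
    ∃ B : Matrix (Fin n) (Fin n) ℂ, Q = B * Bᴴ := by
  open scoped MatrixOrder in
  obtain ⟨B, hB⟩ := CStarAlgebra.nonneg_iff_eq_star_mul_self.mp hQ.nonneg
  exact ⟨star B, by rw [hB, ← Matrix.star_eq_conjTranspose, star_star]⟩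

theorem re_trace_conjTranspose_mul_self_nonneg (H : Matrix (Fin nr) (Fin n) ℂ) :
    0 ≤ (Hᴴ * H).trace.re := by
  rw [re_trace_conjTranspose_mul]
  positivity

/-- Writing `Q = B B†` and exchanging the factors gives an `n × n` determinant, so the exponent is
`n` and not `nr`. This matches the growth `n log P` of the lattice rate. -/
theorem re_det_one_add_mul_le {Q : Matrix (Fin n) (Fin n) ℂ} (hQ : Q.PosSemidef) {P : ℝ}
    (hP : Q.trace.re ≤ P) (H : Matrix (Fin nr) (Fin n) ℂ) :
    (1 + H * Q * Hᴴ).det.re ≤ (1 + P * (Hᴴ * H).trace.re) ^ n := by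
  obtain ⟨B, rfl⟩ := exists_eq_mul_conjTranspose hQ
  have h1 : H * (B * Bᴴ) * Hᴴ = (H * B) * (H * B)ᴴ := by
    simp only [Matrix.conjTranspose_mul, Matrix.mul_assoc]
  have hpsd := Matrix.posSemidef_conjTranspose_mul_self (H * B)
  rw [h1, Matrix.det_one_add_mul_comm]
  refine hpsd.re_det_one_add_le.trans ?_
  rw [Fintype.card_fin]
  have h2 := re_trace_mul_conjTranspose_mul_le H B
  rw [Matrix.trace_mul_comm, Matrix.trace_mul_comm H] at h2
  have h3 : 0 ≤ ((H * B)ᴴ * (H * B)).trace.re := re_trace_conjTranspose_mul_self_nonneg _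
  gcongr
  rw [mul_comm P]
  exact h2.trans (mul_le_mul_of_nonneg_left hP (re_trace_conjTranspose_mul_self_nonneg H))

theorem one_add_mul_trace_le {c : ℝ} (hc : 0 ≤ c) (H : Matrix (Fin nr) (Fin n) ℂ) :
    1 + c * (Hᴴ * H).trace.re ≤
      (1 + H * ((c : ℂ) • (1 : Matrix (Fin n) (Fin n) ℂ)) * Hᴴ).det.re := by
  have hpsd : ((c : ℂ) • (Hᴴ * H)).PosSemidef :=
    (Matrix.posSemidef_conjTranspose_mul_self H).smul (by exact_mod_cast hc)
  have h := hpsd.one_add_re_trace_le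
  have h1 : H * ((c : ℂ) • (1 : Matrix (Fin n) (Fin n) ℂ)) * Hᴴ = H * ((c : ℂ) • Hᴴ) := by
    rw [Matrix.mul_smul, Matrix.mul_one, Matrix.smul_mul, Matrix.mul_smul]
  rw [h1, Matrix.det_one_add_mul_comm, Matrix.smul_mul]
  rw [Matrix.trace_smul, smul_eq_mul, Complex.re_ofReal_mul] at h
  exact h

variable {Ω : Type*} [MeasurableSpace Ω] {μ : Measure Ω}
  {H : Ω → Matrix (Fin nr) (Fin n) ℂ}

/-- Tests the supremum with `Q = (P₀/n) I`, which turns finite capacity at a single power into a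
logarithmic moment of the channel. -/
theorem lintegral_logb_trace_le (hn : 0 < n) {P₀ : ℝ} (hP₀ : 0 < P₀) :
    ∫⁻ ω, ENNReal.ofReal (Real.logb 2 (1 + P₀ / n * ((H ω)ᴴ * H ω).trace.re)) ∂μ ≤
      ergodicCapacity μ H P₀ := by
  have hn' : (0 : ℝ) < n := by exact_mod_cast hn
  have hc : 0 ≤ P₀ / n := by positivity
  have hsup : ∀ Q : Matrix (Fin n) (Fin n) ℂ, Q.PosSemidef ∧ Q.trace.re ≤ P₀ →
      ∫⁻ ω, ENNReal.ofReal (Real.logb 2 ((1 + H ω * Q * (H ω)ᴴ).det).re) ∂μ ≤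
        ergodicCapacity μ H P₀ := fun Q hQ => le_iSup_of_le Q (le_iSup_of_le hQ le_rfl)
  refine le_trans ?_ (hsup (((P₀ / n : ℝ) : ℂ) • (1 : Matrix (Fin n) (Fin n) ℂ)) ⟨?_, ?_⟩)
  · refine lintegral_mono fun ω => ENNReal.ofReal_le_ofReal ?_
    have h0 := mul_nonneg hc (re_trace_conjTranspose_mul_self_nonneg (H ω))
    exact Real.logb_le_logb_of_le (by norm_num) (by linarith) (one_add_mul_trace_le hc (H ω))
  · exact Matrix.PosSemidef.one.smul (by exact_mod_cast hc)
  · rw [Matrix.trace_smul, Matrix.trace_one, smul_eq_mul, Complex.re_ofReal_mul, Fintype.card_fin,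
      Complex.natCast_re]
    exact le_of_eq (by field_simp)

variable [IsProbabilityMeasure μ]

/-- Rests on `1 + P T ≤ max 1 (P / c) * (1 + c T)`, which moves all dependence on `P` out of the
integral. -/
theorem ergodicCapacity_le (hH : Measurable H) {c P : ℝ} (hc : 0 < c)
    (hP : 0 < P) :
    ergodicCapacity μ H P ≤
      n * ∫⁻ ω, ENNReal.ofReal (Real.logb 2 (1 + c * ((H ω)ᴴ * H ω).trace.re)) ∂μ +
        ENNReal.ofReal (n * Real.logb 2 (max 1 (P / c))) := by
  unfold ergodicCapacity
  refine iSup₂_le fun Q hQ => ?_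
  have hmeas : Measurable fun ω =>
      ENNReal.ofReal (Real.logb 2 (1 + c * ((H ω)ᴴ * H ω).trace.re)) := by
    refine ENNReal.measurable_ofReal.comp ?_
    simp only [Real.logb]
    refine (Real.measurable_log.comp ((Measurable.const_mul ?_ c).const_add 1)).div_const _
    simp only [← Matrix.trace_mul_comm (H _)]
    exact measurable_re_trace_mul_conjTranspose hH
  calc ∫⁻ ω, ENNReal.ofReal (Real.logb 2 ((1 + H ω * Q * (H ω)ᴴ).det).re) ∂μ
      ≤ ∫⁻ ω, (n * ENNReal.ofReal (Real.logb 2 (1 + c * ((H ω)ᴴ * H ω).trace.re)) +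
        ENNReal.ofReal (n * Real.logb 2 (max 1 (P / c)))) ∂μ := by
        refine lintegral_mono fun ω => ?_
        set T := ((H ω)ᴴ * H ω).trace.re with hT
        have hT0 : 0 ≤ T := re_trace_conjTranspose_mul_self_nonneg _
        have hcT : 1 ≤ 1 + c * T := by nlinarith
        have hm1 : 1 ≤ max 1 (P / c) := le_max_left _ _
        have hPm : P ≤ max 1 (P / c) * c := by
          rw [← div_le_iff₀ hc]; exact le_max_right _ _
        have hle : 1 + P * T ≤ max 1 (P / c) * (1 + c * T) := by nlinarith
        have hdet := re_det_one_add_mul_le hQ.1 hQ.2 (H ω)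
        rw [← hT] at hdet
        have hdet1 : 1 ≤ (1 + H ω * Q * (H ω)ᴴ).det.re := by
          have hpsd := hQ.1.mul_mul_conjTranspose_same (H ω)
          refine le_trans ?_ hpsd.one_add_re_trace_le
          have := (Complex.le_def.1 hpsd.trace_nonneg).1
          simpa using this
        have key : Real.logb 2 ((1 + H ω * Q * (H ω)ᴴ).det).re ≤
            n * Real.logb 2 (1 + c * T) + n * Real.logb 2 (max 1 (P / c)) := by
          rw [← mul_add, add_comm (Real.logb 2 (1 + c * T)), ← Real.logb_mul (by positivity) (by positivity),
            ← Real.logb_pow]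
          refine Real.logb_le_logb_of_le (by norm_num) (one_pos.trans_le hdet1) (hdet.trans ?_)
          gcongr
        refine (ENNReal.ofReal_le_ofReal key).trans (ENNReal.ofReal_add_le.trans ?_)
        rw [ENNReal.ofReal_mul (by positivity), ENNReal.ofReal_natCast]
    _ = _ := by
        rw [lintegral_add_right _ measurable_const, lintegral_const_mul _ hmeas]
        simp

theorem integral_logDet (hrank : ∀ᵐ ω ∂μ, (H ω).rank = n) {c : ℝ} (hc : 0 < c)
    (hint : Integrable (fun ω => logDet 1 (H ω)) μ) :
    ∫ ω, logDet c (H ω) ∂μ = n * Real.logb 2 c + ∫ ω, logDet 1 (H ω) ∂μ := by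
  have : (fun ω => logDet c (H ω)) =ᵐ[μ] fun ω => n * Real.logb 2 c + logDet 1 (H ω) := by
    filter_upwards [hrank] with ω hω
    have hd := re_det_pos_of_rank hω
    simp only [logDet, Complex.ofReal_one, one_smul, Matrix.det_smul, Fintype.card_fin]
    rw [← Complex.ofReal_pow, Complex.re_ofReal_mul,
      Real.logb_mul (by positivity) hd.ne', Real.logb_pow]
  rw [integral_congr_ae this, integral_add (integrable_const _) hint]
  simp

/-- The lattice rate is `n log₂ P` up to an additive constant. -/
theorem latticeRate_eq (hn : 0 < n) (hrank : ∀ᵐ ω ∂μ, (H ω).rank = n)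
    (hint : Integrable (fun ω => logDet 1 (H ω)) μ) (CL : ℝ) {P : ℝ} (hP : 0 < P) :
    latticeRate μ H CL P = n * Real.logb 2 P + latticeRate μ H CL 1 := by
  have hn' : (0 : ℝ) < n := by exact_mod_cast hn
  rw [latticeRate, latticeRate, integral_logDet hrank (by positivity) hint,
    integral_logDet (c := 1 / n) hrank (by positivity) hint, Real.logb_div hP.ne' hn'.ne',
    Real.logb_div one_ne_zero hn'.ne', Real.logb_one]
  ring

theorem exists_capacity_gap (hn : 0 < n) (hH : Measurable H)
    (hrank : ∀ᵐ ω ∂μ, (H ω).rank = n)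
    (hint : Integrable (fun ω => logDet 1 (H ω)) μ) (CL : ℝ)
    (hcap : ∃ P₀ : ℝ, 0 < P₀ ∧ ergodicCapacity μ H P₀ ≠ ∞) :
    ∃ Δ : ℝ, ∀ P : ℝ, 0 < P →
      ergodicCapacity μ H P ≤ ENNReal.ofReal (max 0 (latticeRate μ H CL P) + Δ) := by
  obtain ⟨P₀, hP₀, hfin⟩ := hcap
  have hn' : (0 : ℝ) < n := by exact_mod_cast hn
  set c := P₀ / n with hc
  have hc0 : 0 < c := by positivity
  set I := ∫⁻ ω, ENNReal.ofReal (Real.logb 2 (1 + c * ((H ω)ᴴ * H ω).trace.re)) ∂μ with hI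
  have hIfin : I ≠ ∞ := ne_top_of_le_ne_top hfin (lintegral_logb_trace_le hn hP₀)
  set A := latticeRate μ H CL 1 with hA
  -- The first term pays for the logarithmic moment, the second for the difference of the constants
  -- next to `n log P`. For `P ≤ c` the logarithm of the maximum vanishes.
  refine ⟨n * I.toReal + max 0 (-(n * Real.logb 2 c) - A), fun P hP => ?_⟩
  refine (ergodicCapacity_le hH hc0 hP).trans ?_
  have hlog0 : 0 ≤ Real.logb 2 (max 1 (P / c)) :=
    Real.logb_nonneg (by norm_num) (le_max_left _ _)
  rw [← hI, ← ENNReal.ofReal_toReal hIfin, ← ENNReal.ofReal_natCast,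
    ← ENNReal.ofReal_mul (by positivity), ← ENNReal.ofReal_add (by positivity) (by positivity),
    ENNReal.toReal_ofReal ENNReal.toReal_nonneg]
  refine ENNReal.ofReal_le_ofReal ?_
  have hkey : n * Real.logb 2 (max 1 (P / c)) ≤
      max 0 (latticeRate μ H CL P) + max 0 (-(n * Real.logb 2 c) - A) := by
    rcases le_total (P / c) 1 with h | h
    · rw [max_eq_left h, Real.logb_one, mul_zero]
      positivity
    · rw [max_eq_right h, Real.logb_div hP.ne' hc0.ne', latticeRate_eq hn hrank hint CL hP]
      have h1 := le_max_right 0 (n * Real.logb 2 P + A)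
      have h2 := le_max_right 0 (-(n * Real.logb 2 c) - A)
      linarith
  linarith

end Capacity

/-! ### Achievability below the lattice rate -/

section Achievability

variable {Ω 𝓘 : Type*} [MeasurableSpace Ω] [AddMonoidWithOne 𝓘] {μ : Measure Ω} {nr n k r : ℕ}
  {H : 𝓘 → Ω → Matrix (Fin nr) (Fin n) ℂ} {W : ℕ → Ω → Matrix (Fin nr) (Fin n) ℂ}

theorem two_rpow_le_prod_det_rpow (hn : 0 < n) (hk : 0 < k) {h : Blocks nr n k}
    (hh : ∀ i, (h i).rank = n) {e : ℝ} (he : e ≤ (k : ℝ)⁻¹ * ∑ i, logDet 1 (h i)) :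
    (2 : ℝ) ^ (e / n) ≤ (∏ i, ((h i)ᴴ * h i).det.re) ^ (1 / ((n : ℝ) * k)) := by
  have hn' : (0 : ℝ) < n := by exact_mod_cast hn
  have hprod : ∏ i, ((h i)ᴴ * h i).det.re = (2 : ℝ) ^ ∑ i, logDet 1 (h i) := by
    rw [Real.rpow_sum_of_pos (by norm_num)]
    refine Finset.prod_congr rfl fun i _ => ?_
    rw [logDet, Complex.ofReal_one, one_smul,
      Real.rpow_logb (by norm_num) (by norm_num) (re_det_pos_of_rank (hh i))]
  rw [hprod, ← Real.rpow_mul (by norm_num)]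
  refine Real.rpow_le_rpow_of_exponent_le (by norm_num) ?_
  calc e / n ≤ ((k : ℝ)⁻¹ * ∑ i, logDet 1 (h i)) / n := by gcongr
    _ = _ := by field_simp

/-- Lattice decoding errors only occur for bad channels or large noise. -/
theorem measure_naiveLatticeError_le (hH_rank : ∀ i, ∀ᵐ ω ∂μ, (H i ω).rank = n)
    (hn : 0 < n) (hk : 0 < k) {L : MatrixLattice n k r} (hL : L.mindet = 1) {α ε e : ℝ}
    (hα : 4 * ((n : ℝ) ^ 2 * k * (1 + ε)) ≤ α ^ 2 * ((n * k : ℝ) * 2 ^ ((e - ε) / n)))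
    {S X : Blocks n n k} (hX : X ∈ L.shifted α S) :
    μ {ω | NaiveLatticeError (L.shifted α S) (firstBlocks H k ω) X (firstBlocks W k ω)} ≤
      μ {ω | ε ≤ |(k : ℝ)⁻¹ * ∑ i, logDet 1 (firstBlocks H k ω i) - e|} +
      μ {ω | (n : ℝ) ^ 2 * k * (1 + ε) ≤
        normSq (fun i => colProj (firstBlocks H k ω i) * firstBlocks W k ω i)} := by
  refine le_trans (measure_mono_ae ?_) (measure_union_le _ _)
  have hrank : ∀ᵐ ω ∂μ, ∀ i : Fin k, (firstBlocks H k ω i).rank = n :=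
    ae_all_iff.2 fun i => hH_rank _
  filter_upwards [hrank] with ω hω herr
  by_cases hc : ε ≤ |(k : ℝ)⁻¹ * ∑ i, logDet 1 (firstBlocks H k ω i) - e|
  · exact Or.inl hc
  · refine Or.inr ?_
    rw [not_le, abs_lt] at hc
    have h1 := le_normSq_of_naiveLatticeError hn hk hL hX hω herr
    have h2 := two_rpow_le_prod_det_rpow hn hk hω (e := e - ε) (by linarith)
    have h3 : α ^ 2 * ((n * k : ℝ) * 2 ^ ((e - ε) / n)) ≤ α ^ 2 * ((n * k : ℝ) *
        (∏ i, ((firstBlocks H k ω i)ᴴ * firstBlocks H k ω i).det.re) ^ (1 / ((n : ℝ) * k))) := by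
      gcongr
    show (n : ℝ) ^ 2 * k * (1 + ε) ≤ _
    linarith

theorem mlErrorProb_le_naiveErrorProb {C Λ : Set (Blocks n n k)} (hC : C ⊆ Λ) :
    mlErrorProb μ H W C ≤ naiveErrorProb μ H W C Λ :=
  iSup₂_mono fun _ _ => measure_mono fun _ hω => naiveLatticeError_of_mlError hC hω

/-- Below the lattice rate there is room for a positive slack in all estimates. -/
theorem exists_slack (hn : 0 < n) {E CL P R : ℝ} (hCL : 0 < CL) (hP : 0 < P)
    (hR : R < n * Real.logb 2 (P / n) + E - n * Real.logb 2 CL +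
      n * Real.logb 2 (Real.pi * Real.exp 1 / (4 * n))) :
    ∃ ε : ℝ, 0 < ε ∧ 4 * n * (1 + ε) <
      (Real.exp 1 - ε) * (Real.pi / n * P / (2 ^ (R / n) * CL)) * 2 ^ ((E - ε) / n) := by
  have hn' : (0 : ℝ) < n := by exact_mod_cast hn
  have hπ := Real.pi_pos
  have hexp := Real.exp_pos 1
  set g : ℝ → ℝ := fun ε =>
    (Real.exp 1 - ε) * (Real.pi / n * P / (2 ^ (R / n) * CL)) * 2 ^ ((E - ε) / n) -
      4 * n * (1 + ε) with hg
  have hcont : Continuous g := by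
    have : Continuous fun ε : ℝ => (2 : ℝ) ^ ((E - ε) / n) :=
      Continuous.rpow continuous_const (by fun_prop) fun _ => Or.inl (by norm_num)
    fun_prop
  have h0 : 0 < g 0 := by
    -- At `ε = 0` the required inequality is the exponentiated rate condition; continuity then
    -- leaves room for a small positive `ε`.
    have h1 : R / n - E / n < Real.logb 2
        (P / n / CL * (Real.pi * Real.exp 1 / (4 * n))) := by
      rw [Real.logb_mul (by positivity) (by positivity), Real.logb_div (by positivity) hCL.ne',
        ← sub_div, div_lt_iff₀ hn']
      linarith
    rw [Real.lt_logb_iff_rpow_lt (by norm_num) (by positivity),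
      Real.rpow_sub (by norm_num), div_lt_iff₀ (by positivity)] at h1
    have h2 : (0 : ℝ) < 2 ^ (R / n) := by positivity
    simp only [hg, sub_zero, add_zero, mul_one, sub_pos]
    rw [show Real.exp 1 * (Real.pi / n * P / (2 ^ (R / n) * CL)) * 2 ^ (E / n) =
      (4 * n) * (P / n / CL * (Real.pi * Real.exp 1 / (4 * n)) * 2 ^ (E / n)) / 2 ^ (R / n) by
        field_simp, lt_div_iff₀ h2]
    gcongr
  have hev : ∀ᶠ ε in 𝓝[>] (0 : ℝ), 0 < g ε :=
    (hcont.tendsto 0).eventually (lt_mem_nhds h0) |>.filter_mono nhdsWithin_le_nhds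
  obtain ⟨ε, hε1, hε2⟩ := (hev.and self_mem_nhdsWithin).exists
  exact ⟨ε, hε2, by simpa [hg] using hε1⟩

variable [IsProbabilityMeasure μ]

/-- The bound by the two bad events is the same for every codeword, so it survives the supremum over
the code; it is also independent of the shift, which is left free to serve the cardinality. -/
theorem achievable_of_lt_latticeRate (hn : 0 < n) (hH_meas : ∀ i, Measurable (H i))
    (hH_rank : ∀ i, ∀ᵐ ω ∂μ, (H i ω).rank = n) (hH_stat : IsStationary μ H)
    (hH_erg : IsErgodic μ H) (hH_int : Integrable (fun ω => logDet 1 (H 1 ω)) μ)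
    (hW : IsWhiteNoise μ W) (hHW : IndepFun (fun ω i => H i ω) (fun ω j => W j ω) μ)
    {K : Set ℕ} (hK_pos : ∀ k ∈ K, 0 < k) {L : ∀ k : ℕ, MatrixLattice n k (2 * n ^ 2 * k)}
    {CL : ℝ} (hCL : 0 < CL) (hL_det : ∀ k ∈ K, (L k).mindet = 1)
    (hL_vol : ∀ k ∈ K, (L k).vol ^ (1 / ((n : ℝ) ^ 2 * k)) ≤ CL)
    {P R : ℝ} (hP : 0 < P) (hR : R < latticeRate μ (H 1) CL P) :
    Achievable μ H W K L P R := by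
  have hn' : (0 : ℝ) < n := by exact_mod_cast hn
  have hπ := Real.pi_pos
  set E := ∫ ω, logDet 1 (H 1 ω) ∂μ with hE
  rw [latticeRate, integral_logDet (hH_rank 1) (by positivity) hH_int, ← hE] at hR
  obtain ⟨ε, hε, hslack⟩ := exists_slack hn hCL hP hR
  set D := Real.pi / n * P / (2 ^ (R / n) * CL) with hD
  have hD0 : 0 < D := by positivity
  have hS : ∀ k : ℕ, ∃ S : Blocks n n k, k ∈ K →
      (2 : ℝ) ^ (R * n * k) ≤ (((L k).code P ((L k).scaling P R) S).ncard : ℝ) := by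
    intro k
    by_cases hk : k ∈ K
    · obtain ⟨S, hS⟩ := (L k).exists_shift hn (hK_pos k hk) hP R
      exact ⟨S, fun _ => hS⟩
    · exact ⟨0, fun h => absurd h hk⟩
  choose S hS using hS
  have hnaive : Tendsto (fun k => naiveErrorProb μ H W
      ((L k).code P ((L k).scaling P R) (S k))
      ((L k).shifted ((L k).scaling P R) (S k))) (atTop ⊓ 𝓟 K) (𝓝 0) := by
    have hlim1 := tendsto_measure_logDet_average hH_meas hH_stat hH_erg hH_int hε
    have hlim2 : Tendsto (fun k : ℕ =>
        ENNReal.ofReal (k * energyVar nr n / ((n : ℝ) ^ 2 * k * ε) ^ 2)) atTop (𝓝 0) := by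
      rw [← ENNReal.ofReal_zero]
      refine ENNReal.tendsto_ofReal ?_
      have h := (tendsto_inv_atTop_nhds_zero_nat (𝕜 := ℝ)).mul_const
        (energyVar nr n / ((n : ℝ) ^ 2 * ε) ^ 2)
      rw [zero_mul] at h
      refine h.congr' ?_
      filter_upwards [eventually_ne_atTop 0] with k hk
      have hk' : (k : ℝ) ≠ 0 := by exact_mod_cast hk
      field_simp
    have hlim := (hlim1.add hlim2).mono_left (inf_le_left : atTop ⊓ 𝓟 K ≤ atTop)
    rw [add_zero] at hlim
    refine tendsto_of_tendsto_of_tendsto_of_le_of_le' tendsto_const_nhds hlim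
      (Eventually.of_forall fun _ => zero_le) ?_
    have hNk : Tendsto (fun k : ℕ => n ^ 2 * k) atTop atTop :=
      tendsto_id.const_mul_atTop' (by positivity)
    -- The same `ε` absorbs the Stirling error: the factor exceeds `e - ε` for all large `k`.
    have hfac := (tendsto_div_factorial_rpow.comp hNk).eventually
      (lt_mem_nhds (show Real.exp 1 - ε < Real.exp 1 by linarith))
    rw [eventually_inf_principal]
    filter_upwards [hfac] with k hk hkK
    have hk0 := hK_pos k hkK
    have hk' : (0 : ℝ) < k := by exact_mod_cast hk0
    have hα := (L k).le_scaling_sq hn hk0 hP R (hL_vol k hkK)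
    rw [← hD] at hα
    have hα2 : (Real.exp 1 - ε) * D ≤ (L k).scaling P R ^ 2 :=
      (mul_le_mul_of_nonneg_right hk.le hD0.le).trans hα
    have hα3 : 4 * ((n : ℝ) ^ 2 * k * (1 + ε)) ≤
        (L k).scaling P R ^ 2 * ((n * k : ℝ) * 2 ^ ((E - ε) / n)) := by
      calc 4 * ((n : ℝ) ^ 2 * k * (1 + ε)) = (n * k) * (4 * n * (1 + ε)) := by ring
        _ ≤ (n * k) * ((Real.exp 1 - ε) * D * 2 ^ ((E - ε) / n)) := by gcongr
        _ ≤ (n * k) * ((L k).scaling P R ^ 2 * 2 ^ ((E - ε) / n)) := by gcongr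
        _ = _ := by ring
    refine iSup₂_le fun X hX => ?_
    exact (measure_naiveLatticeError_le hH_rank hn hk0 (hL_det k hkK) hα3 hX.2).trans
      (add_le_add_right (hW.measure_le hH_meas hH_rank hHW hn hk0 hε) _)
  refine ⟨S, fun k hk => hS k hk, ?_, hnaive⟩
  exact tendsto_of_tendsto_of_tendsto_of_le_of_le tendsto_const_nhds hnaive (fun _ => zero_le)
    fun k => mlErrorProb_le_naiveErrorProb Set.inter_subset_right

end Achievability

end Multiblock

end

theorem mainTheorem4
    {Ω : Type*} [MeasurableSpace Ω] (μ : Measure Ω) [IsProbabilityMeasure μ]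
    -- the index set of the fading process; the cases of interest are `ℕ` and `ℤ`
    {𝓘 : Type*} [AddMonoidWithOne 𝓘]
    (n nr : ℕ) (hn : 0 < n) (hnr : n ≤ nr)
    -- the fading process
    (H : 𝓘 → Ω → Matrix (Fin nr) (Fin n) ℂ)
    (hH_meas : ∀ i, Measurable (H i))
    (hH_rank : ∀ i, ∀ᵐ ω ∂μ, (H i ω).rank = n)
    (hH_stat : Multiblock.IsStationary μ H)
    (hH_erg : Multiblock.IsErgodic μ H)
    (hH_iso : Multiblock.IsIsotropic μ H)
    (hH_int : Integrable (fun ω => Multiblock.logDet 1 (H 1 ω)) μ)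
    -- the noise, independent of the fading process
    (W : ℕ → Ω → Matrix (Fin nr) (Fin n) ℂ)
    (hW : Multiblock.IsWhiteNoise μ W)
    (hHW : IndepFun (fun ω i => H i ω) (fun ω j => W j ω) μ)
    -- the family of lattices, indexed by an infinite set `K` of block lengths
    (K : Set ℕ) (hK : K.Infinite) (hK_pos : ∀ k ∈ K, 0 < k)
    (L : ∀ k : ℕ, Multiblock.MatrixLattice n k (2 * n ^ 2 * k))
    (CL : ℝ) (hCL : 0 < CL)
    (hL_det : ∀ k ∈ K, (L k).mindet = 1)
    (hL_vol : ∀ k ∈ K, (L k).vol ^ (1 / ((n : ℝ) ^ 2 * k)) ≤ CL) :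
    -- every rate below the lattice rate is achievable with both decoders
    (∀ P : ℝ, 0 < P → ∀ R : ℝ, R < Multiblock.latticeRate μ (H 1) CL P →
      Multiblock.Achievable μ H W K L P R) ∧
    -- the positive part of the lattice rate is within a constant of the capacity, at every power
    ((∃ P₀ : ℝ, 0 < P₀ ∧ Multiblock.ergodicCapacity μ (H 1) P₀ ≠ ∞) →
      ∃ Δ : ℝ, ∀ P : ℝ, 0 < P →
        Multiblock.ergodicCapacity μ (H 1) P ≤
          ENNReal.ofReal (max 0 (Multiblock.latticeRate μ (H 1) CL P) + Δ)) := by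
  exact ⟨fun P hP R hR => Multiblock.achievable_of_lt_latticeRate hn hH_meas hH_rank hH_stat hH_erg
    hH_int hW hHW hK_pos hCL hL_det hL_vol hP hR,
    Multiblock.exists_capacity_gap hn (hH_meas 1) (hH_rank 1) hH_int CL⟩
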